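/- A transition-based Emerson–Lei automaton (TELA) is a tuple $\mathcal A=(Q,\Sigma,\delta,I,\alpha)$ with finite $Q$, finite alphabet $\Sigma$, $\delta\subseteq Q\times\Sigma\times Q$, $I\subseteq Q$, and $\alpha$ a positive Boolean combination of $\mathrm{true}$, $\mathrm{false}$, $\mathrm{Inf}(T)$ and $\mathrm{Fin}(T)$ with $T\subseteq\delta$. A run (an infinite path starting in $I$) is accepting if its set $\inf(\rho)$ of infinitely often taken transitions satisfies $\alpha$, where $\mathrm{Inf}(T)$ means $\inf(\rho)\cap T\neq\varnothing$ and $\mathrm{Fin}(T)$ means $\inf(\rho)\cap T=\varnothing$. $\mathcal A$ is deterministic if $|I|=1$ and $\delta$ is a function $Q\times\Sigma\to Q$. It is limit-deterministic if $Q$ has a partition into (possibly empty) sets $Q_N,Q_D$ such that no transition leads from $Q_D$ to $Q_N$, every state of $Q_D$ has at most one successor for each letter, and every accepting run satisfies $\inf(\rho)\cap(Q_N\times\Sigma\times Q_N)=\varnothing$. The size $|\mathcal A|$ is the number of states. A generalized Büchi automaton (GBA) with $K$ acceptance sets is a TELA with $\alpha=\bigwedge_{j\le K}\mathrm{Inf}(T_j)$.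 The sum $\mathcal A_0\oplus\mathcal A_1$ is the disjoint union with acceptance condition $(\alpha_0\wedge\mathrm{Inf}(\delta_0))\vee(\alpha_1\wedge\mathrm{Inf}(\delta_1))$; $\bigoplus$ denotes its iteration. Let $\mathcal A$ be a TELA in DNF, that is, $\alpha=\bigvee_{1\le i\le m}\alpha_i$ with $\alpha_i=\mathrm{Fin}(T^i_0)\wedge\bigwedge_{1\le j\le k_i}\mathrm{Inf}(T^i_j)$ and all $k_i\ge1$. Put $n=|\mathcal A|$ and $k=\max_i k_i$, and let $\mathcal A_i$ be $\mathcal A$ with acceptance condition $\alpha_i$. Let $\mathrm{removeFin}(\mathcal A_i)$ be the following GBA with $k_i$ acceptance sets. Its states are $Q\cup\{q^{(i)}: q\in Q\}$, its initial states are $I$, and its transitions are those of $\delta$, all $(q,a,q'^{(i)})$ with $(q,a,q')\in\delta$, and all $(q^{(i)},a,q'^{(i)})$ with $(q,a,q')\in\delta\setminus T^i_0$. Its acceptance condition is $\bigwedge_{1\le j\le k_i}\mathrm{Inf}(\{(q^{(i)},a,q'^{(i)}):(q,a,q')\in T^i_j\setminus T^i_0\})$. A GBA-determinization procedure is a map $\det$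 that assigns to every GBA (over any finite alphabet) a deterministic TELA with the same language. It is called optimal if there is a constant $C$ such that $|\det(\mathcal G)|\le 2^{C\,N(\log_2 N+\log_2 K)}$ for every GBA $\mathcal G$ with $N$ states and $K$ acceptance sets, $NK\ge2$. **Proposition.** 1. An optimal GBA-determinization procedure exists. 2. For every GBA-determinization procedure $\det$ and every TELA $\mathcal A$ in DNF, the automaton $\mathcal S=\bigoplus_{1\le i\le m}\det(\mathrm{removeFin}(\mathcal A_i))$ is limit-deterministic, and $|\mathcal S|=\sum_{1\le i\le m}|\det(\mathrm{removeFin}(\mathcal A_i))|$. 3. If $\det$ is optimal, then moreover $|\mathcal S|= m\cdot 2^{O(n(\log n+\log k))}$, i.e. there is a constant $C'$, depending only on $\det$, such that $|\mathcal S|\le m\cdot 2^{C'n(\log_2 n+\log_2 k)}$ for all TELA $\mathcal A$ in DNF with $nk\ge2$. -/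

import Mathlib

open Filter

/-- Symbolic Emerson-Lei acceptance conditions whose atoms are sets over `X`. -/
inductive ELCond (X : Type) : Type
  | tt : ELCond X
  | ff : ELCond X
  | infAtom (T : Set X) : ELCond X
  | finAtom (T : Set X) : ELCond X
  | or (a b : ELCond X) : ELCond X
  | and (a b : ELCond X) : ELCond X

namespace ELCond

variable {X Y : Type}

/-- `Sat S a` is `S ⊨ a`. -/
def Sat (S : Set X) : ELCond X → Prop
  | tt => True
  | ff => False
  | infAtom T => (S ∩ T).Nonempty
  | finAtom T => S ∩ T = ∅
  | or a b => Sat S a ∨ Sat S b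
  | and a b => Sat S a ∧ Sat S b

/-- All sets in the atoms of the condition are subsets of `D`. -/
def Over (D : Set X) : ELCond X → Prop
  | tt => True
  | ff => True
  | infAtom T => T ⊆ D
  | finAtom T => T ⊆ D
  | or a b => Over D a ∧ Over D b
  | and a b => Over D a ∧ Over D b

/-- Replace every set `T` in an atom by `f T`. -/
def map (f : Set X → Set Y) : ELCond X → ELCond Y
  | tt => tt
  | ff => ff
  | infAtom T => infAtom (f T)
  | finAtom T => finAtom (f T)
  | or a b => or (map f a) (map f b)
  | and a b => and (map f a) (map f b)

/-- Finite disjunction; a disjunction of one formula is the formula itself. -/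
def bigOr : List (ELCond X) → ELCond X
  | [] => ff
  | [a] => a
  | a :: b :: l => or a (bigOr (b :: l))

/-- Finite conjunction; a conjunction of one formula is the formula itself. -/
def bigAnd : List (ELCond X) → ELCond X
  | [] => tt
  | [a] => a
  | a :: b :: l => and a (bigAnd (b :: l))

/-- The generalized Büchi condition with acceptance sets `T 0, …, T (K - 1)`. -/
def genBuchi {K : ℕ} (T : Fin K → Set X) : ELCond X :=
  bigAnd (List.ofFn fun j => infAtom (T j))

/-- The disjunct `Fin(T₀) ∧ ⋀ⱼ Inf(Tⱼ)` of a condition in disjunctive normal form. -/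
def dnfDisjunct {k : ℕ} (T₀ : Set X) (T : Fin k → Set X) : ELCond X :=
  and (finAtom T₀) (bigAnd (List.ofFn fun j => infAtom (T j)))

theorem over_bigOr {D : Set X} : ∀ {l : List (ELCond X)},
    Over D (bigOr l) ↔ ∀ a ∈ l, Over D a
  | [] => by simp [bigOr, Over]
  | [a] => by simp [bigOr]
  | a :: b :: l => by
      have ih := over_bigOr (D := D) (l := b :: l)
      simp only [bigOr, Over, ih, List.forall_mem_cons]

theorem over_bigAnd {D : Set X} : ∀ {l : List (ELCond X)},
    Over D (bigAnd l) ↔ ∀ a ∈ l, Over D a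
  | [] => by simp [bigAnd, Over]
  | [a] => by simp [bigAnd]
  | a :: b :: l => by
      have ih := over_bigAnd (D := D) (l := b :: l)
      simp only [bigAnd, Over, ih, List.forall_mem_cons]

theorem Over.map {D : Set X} {E : Set Y} {f : Set X → Set Y}
    (hf : ∀ T, T ⊆ D → f T ⊆ E) : ∀ {a : ELCond X}, Over D a → Over E (a.map f)
  | .tt, _ => trivial
  | .ff, _ => trivial
  | .infAtom _, h => hf _ h
  | .finAtom _, h => hf _ h
  | .or _ _, h => ⟨Over.map hf h.1, Over.map hf h.2⟩
  | .and _ _, h => ⟨Over.map hf h.1, Over.map hf h.2⟩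

end ELCond

/-- A transition `(q, a, q')`. -/
abbrev Edge (Q Sym : Type) : Type := Q × Sym × Q

/-- The image of a set of transitions when sources are renamed by `f` and targets by `g`. -/
def liftTrans {Q Q' Sym : Type} (f g : Q → Q') (T : Set (Edge Q Sym)) : Set (Edge Q' Sym) :=
  (fun t => (f t.1, t.2.1, g t.2.2)) '' T

/-- A transition-based Emerson-Lei automaton over the alphabet `Sym`. -/
structure TELA (Sym : Type) where
  State : Type
  finite : Finite State
  δ : Set (Edge State Sym)
  init : Set State
  acc : ELCond (Edge State Sym)
  acc_over : acc.Over δ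

namespace TELA

variable {Sym : Type}

/-- The number of states. -/
noncomputable def size (A : TELA Sym) : ℕ := Nat.card A.State

/-- `ρ` is a run of `A` for the infinite word `w`. -/
def IsRun (A : TELA Sym) (w : ℕ → Sym) (ρ : ℕ → Edge A.State Sym) : Prop :=
  (ρ 0).1 ∈ A.init ∧ (∀ i, ρ i ∈ A.δ) ∧ (∀ i, (ρ i).2.1 = w i) ∧
    ∀ i, (ρ i).2.2 = (ρ (i + 1)).1

/-- The set of transitions that appear infinitely often. -/
def infSet {X : Type} (ρ : ℕ → X) : Set X := {t | ∃ᶠ i in atTop, ρ i = t}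

/-- `ρ` is an accepting run of `A` for `w`. -/
def IsAcceptingRun (A : TELA Sym) (w : ℕ → Sym) (ρ : ℕ → Edge A.State Sym) : Prop :=
  A.IsRun w ρ ∧ A.acc.Sat (infSet ρ)

def language (A : TELA Sym) : Set (ℕ → Sym) := {w | ∃ ρ, A.IsAcceptingRun w ρ}

/-- Exactly one initial state, and the transition relation is a (total) function. -/
def IsDeterministic (A : TELA Sym) : Prop :=
  (∃! q, q ∈ A.init) ∧ ∀ q a, ∃! q', (q, a, q') ∈ A.δ

/-- Limit-determinism, for the partition of the states into `QD` and its complement. -/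
def IsLimitDeterministic (A : TELA Sym) : Prop :=
  ∃ QN QD : Set A.State, Disjoint QN QD ∧ QN ∪ QD = Set.univ ∧
    (∀ q a q', (q, a, q') ∈ A.δ → q ∈ QD → q' ∉ QN) ∧
    (∀ q ∈ QD, ∀ a q₁ q₂, (q, a, q₁) ∈ A.δ → (q, a, q₂) ∈ A.δ → q₁ = q₂) ∧
    ∀ w ρ, A.IsAcceptingRun w ρ → ∀ t ∈ infSet ρ, ¬ (t.1 ∈ QN ∧ t.2.2 ∈ QN)

/-- The sum (disjoint union) of two automata, with acceptance condition
`(α₀ ∧ Inf(δ₀)) ∨ (α₁ ∧ Inf(δ₁))`. -/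
def sum (A B : TELA Sym) : TELA Sym where
  State := A.State ⊕ B.State
  finite := by
    have := A.finite
    have := B.finite
    infer_instance
  δ := liftTrans Sum.inl Sum.inl A.δ ∪ liftTrans Sum.inr Sum.inr B.δ
  init := Sum.inl '' A.init ∪ Sum.inr '' B.init
  acc :=
    .or (.and (A.acc.map (liftTrans Sum.inl Sum.inl)) (.infAtom (liftTrans Sum.inl Sum.inl A.δ)))
      (.and (B.acc.map (liftTrans Sum.inr Sum.inr)) (.infAtom (liftTrans Sum.inr Sum.inr B.δ)))
  acc_over :=
    ⟨⟨A.acc_over.map fun _ h => (Set.image_mono h).trans Set.subset_union_left,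
        Set.subset_union_left⟩,
      B.acc_over.map fun _ h => (Set.image_mono h).trans Set.subset_union_right,
        Set.subset_union_right⟩

/-- The automaton without states; it only serves as the value of the empty sum. -/
def empty : TELA Sym where
  State := Empty
  finite := inferInstance
  δ := ∅
  init := ∅
  acc := .ff
  acc_over := trivial

/-- The iterated sum `A₁ ⊕ (A₂ ⊕ (… ⊕ Aₘ))`. -/
def bigSum : List (TELA Sym) → TELA Sym
  | [] => empty
  | [A] => A
  | A :: B :: l => A.sum (bigSum (B :: l))

/-- A presentation of the acceptance condition of `A` as
`⋁ᵢ (Fin(T₀ i) ∧ ⋀ⱼ Inf(T i j))`, `i < m`, `j < k i`, with all `k i ≥ 1`: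
the automaton `A` is in disjunctive normal form. -/
structure DNF (A : TELA Sym) where
  m : ℕ
  k : Fin m → ℕ
  one_le_k : ∀ i, 1 ≤ k i
  T₀ : Fin m → Set (Edge A.State Sym)
  T : (i : Fin m) → Fin (k i) → Set (Edge A.State Sym)
  acc_eq : A.acc = ELCond.bigOr (List.ofFn fun i => ELCond.dnfDisjunct (T₀ i) (T i))

namespace DNF

variable {A : TELA Sym}

/-- The maximal number of `Inf`-atoms in a disjunct. -/
def maxK (D : A.DNF) : ℕ := Finset.univ.sup D.k

theorem disjunct_over (D : A.DNF) (i : Fin D.m) :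
    (ELCond.dnfDisjunct (D.T₀ i) (D.T i)).Over A.δ := by
  have h := A.acc_over
  rw [D.acc_eq, ELCond.over_bigOr] at h
  exact h _ (by simp)

theorem T_subset (D : A.DNF) (i : Fin D.m) (j : Fin (D.k i)) : D.T i j ⊆ A.δ :=
  ELCond.over_bigAnd.1 (D.disjunct_over i).2 (.infAtom (D.T i j)) (by simp)

/-- The automaton `A` with its acceptance condition restricted to the `i`-th disjunct. -/
def splitAut (D : A.DNF) (i : Fin D.m) : TELA Sym where
  State := A.State
  finite := A.finite
  δ := A.δ
  init := A.init
  acc := ELCond.dnfDisjunct (D.T₀ i) (D.T i)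
  acc_over := D.disjunct_over i

/-- The restricted automaton is again in disjunctive normal form, with one disjunct. -/
def splitDNF (D : A.DNF) (i : Fin D.m) : (D.splitAut i).DNF where
  m := 1
  k := fun _ => D.k i
  one_le_k := fun _ => D.one_le_k i
  T₀ := fun _ => D.T₀ i
  T := fun _ => D.T i
  acc_eq := rfl

/-- States of `removeFin`: a main copy and one further copy for each disjunct. -/
abbrev RFState (D : A.DNF) : Type := A.State ⊕ (Fin D.m × A.State)

/-- The embedding of the states of `A` into the `i`-th copy. -/
def copy (D : A.DNF) (i : Fin D.m) (q : A.State) : D.RFState := Sum.inr (i, q)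

/-- Transitions: those of the main copy, those of the `i`-th copy (where `T₀ i` is removed),
and those that lead from the main copy into the `i`-th copy. -/
def rfδ (D : A.DNF) : Set (Edge D.RFState Sym) :=
  liftTrans Sum.inl Sum.inl A.δ ∪
    ⋃ i, (liftTrans (D.copy i) (D.copy i) (A.δ \ D.T₀ i) ∪ liftTrans Sum.inl (D.copy i) A.δ)

/-- The fin-less automaton obtained from an automaton in disjunctive normal form. -/
def removeFin (D : A.DNF) : TELA Sym where
  State := D.RFState
  finite := by
    have := A.finite
    infer_instance
  δ := D.rfδ
  init := Sum.inl '' A.init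
  acc := ELCond.bigOr (List.ofFn fun i =>
    ELCond.bigAnd (List.ofFn fun j =>
      .infAtom (liftTrans (D.copy i) (D.copy i) (D.T i j \ D.T₀ i))))
  acc_over := by
    simp only [ELCond.over_bigOr, List.forall_mem_ofFn_iff, ELCond.over_bigAnd, ELCond.Over]
    intro i j
    have h : D.T i j \ D.T₀ i ⊆ A.δ \ D.T₀ i := Set.sdiff_subset_sdiff_left (D.T_subset i j)
    exact ((Set.image_mono h).trans Set.subset_union_left).trans
      ((Set.subset_iUnion (fun i => liftTrans (D.copy i) (D.copy i) (A.δ \ D.T₀ i) ∪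
        liftTrans Sum.inl (D.copy i) A.δ) i).trans Set.subset_union_right)

/-- The sum over all disjuncts `i` of `det (removeFin Aᵢ)`, where `Aᵢ` is `A` restricted to
the `i`-th disjunct. -/
def limitDetSum (D : A.DNF) (det : TELA Sym → TELA Sym) : TELA Sym :=
  bigSum (List.ofFn fun i => det (D.splitDNF i).removeFin)

end DNF

end TELA

/-- `det` maps every generalized Büchi automaton (over any finite alphabet) to a deterministic
automaton with the same language; its values on other automata are irrelevant. -/
def IsGBADeterminization (det : ∀ Sym : Type, TELA Sym → TELA Sym) : Prop :=
  ∀ (Sym : Type) [Finite Sym] (G : TELA Sym) (K : ℕ) (T : Fin K → Set (Edge G.State Sym)),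
    G.acc = ELCond.genBuchi T →
      (det Sym G).IsDeterministic ∧ (det Sym G).language = G.language

/-- `det` maps generalized Büchi automata with `N` states and `K` acceptance sets to automata
with `2 ^ O(N (log N + log K))` states. The exponent vanishes for `N * K = 1`, and the
logarithms are not defined for `N * K = 0`. -/
def HasOptimalSize (det : ∀ Sym : Type, TELA Sym → TELA Sym) : Prop :=
  ∃ C : ℝ, ∀ (Sym : Type) [Finite Sym] (G : TELA Sym) (K : ℕ)
    (T : Fin K → Set (Edge G.State Sym)), G.acc = ELCond.genBuchi T → 2 ≤ G.size * K →
      ((det Sym G).size : ℝ) ≤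
        (2 : ℝ) ^ (C * (G.size * (Real.logb 2 G.size + Real.logb 2 K)))

/-! The second and third claims need only determinism of the summands: in a disjoint sum every state
still has at most one successor per letter, so the nondeterministic part can be empty, sizes add up,
and doubling the states in `removeFin` only changes the constant in the exponent. The substance is
the first claim.

Let a run await the acceptance sets cyclically and write 0 when it takes a transition of the awaited
set, 1 otherwise; it accepts iff it writes infinitely many zeros. Every reachable state keeps its
lexicographically least history (`hist`). At time `t`, level `s` records which states agree on the
first `s` digits and which have a zero after them. The levels form a chain in a finite order, and a
letter acts on all of them by one map `upd`, so levels merge but never split. Counting distinct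
levels shows that some level eventually absorbs each later one; the chain reveals this, since the
first `c` positions survive while position `c + 1` vanishes or is missing infinitely often
(`exists_absorbing`, `absorbing_of_collapse`). For an absorbing level, "some class consists of
states with a zero since `s`" implies "with a zero since `r`" for each `r`, eventually. Hence a
Rabin condition on the chain expresses acceptance: `Accepts.exists_stable` in one direction,
`exists_accepts_of_stable` with Kőnig's lemma in the other.

The order of the histories, the counters modulo `M` and the chain determine their own update
(`Similar.cons`). Classes are intervals of the history order, so a level is coded by a subset of `Q
⊕ Q` (`elt_eq_of_trace_eq`), and a chain of subsets by its cardinalities and one number per point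
(`ChainCode.subset_of_code`). This avoids arbitrary relations on `Q` and leaves `2 ^ O(N (log N +
log K))` states. -/

namespace ELCond

variable {X : Type}

theorem sat_bigOr {S : Set X} : ∀ {l : List (ELCond X)}, Sat S (bigOr l) ↔ ∃ a ∈ l, Sat S a
  | [] => by simp [bigOr, Sat]
  | [a] => by simp [bigOr]
  | a :: b :: l => by
      have ih := sat_bigOr (S := S) (l := b :: l)
      simp only [bigOr, Sat, ih, List.exists_mem_cons_iff]

theorem sat_bigAnd {S : Set X} : ∀ {l : List (ELCond X)}, Sat S (bigAnd l) ↔ ∀ a ∈ l, Sat S a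
  | [] => by simp [bigAnd, Sat]
  | [a] => by simp [bigAnd]
  | a :: b :: l => by
      have ih := sat_bigAnd (S := S) (l := b :: l)
      simp only [bigAnd, Sat, ih, List.forall_mem_cons]

theorem sat_genBuchi {S : Set X} {K : ℕ} {T : Fin K → Set X} :
    Sat S (genBuchi T) ↔ ∀ j, (S ∩ T j).Nonempty := by
  simp only [genBuchi, sat_bigAnd, List.forall_mem_ofFn_iff, Sat]

end ELCond

/-! ### Recurrent transitions and sums of deterministic automata. -/

namespace TELA

theorem infSet_inter_nonempty {X : Type} [Finite X] {ρ : ℕ → X} {T : Set X} :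
    (infSet ρ ∩ T).Nonempty ↔ ∃ᶠ i in atTop, ρ i ∈ T := by
  constructor
  · rintro ⟨t, ht, htT⟩
    exact Frequently.mono ht fun i hi => hi ▸ htT
  · intro h
    by_contra hne
    have : ∀ x, ∀ᶠ i in atTop, ρ i = x → x ∉ T := by
      intro x
      by_cases hx : x ∈ T
      · have : x ∉ infSet ρ := fun hi => hne ⟨x, hi, hx⟩
        exact (not_frequently.1 this).mono fun i hi h => (hi h).elim
      · exact Eventually.of_forall fun _ _ => hx
    exact h ((eventually_all.2 this).mono fun i hi => hi _ rfl)

theorem infSet_inter_eq_empty {X : Type} [Finite X] {ρ : ℕ → X} {T : Set X} :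
    infSet ρ ∩ T = ∅ ↔ ∀ᶠ i in atTop, ρ i ∉ T := by
  rw [← Set.not_nonempty_iff_eq_empty, infSet_inter_nonempty, not_frequently]

variable {Sym : Type}

theorem sum_succ_unique {A B : TELA Sym}
    (hA : ∀ q a q₁ q₂, (q, a, q₁) ∈ A.δ → (q, a, q₂) ∈ A.δ → q₁ = q₂)
    (hB : ∀ q a q₁ q₂, (q, a, q₁) ∈ B.δ → (q, a, q₂) ∈ B.δ → q₁ = q₂) :
    ∀ q a q₁ q₂, (q, a, q₁) ∈ (A.sum B).δ → (q, a, q₂) ∈ (A.sum B).δ → q₁ = q₂ := by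
  intro q a q₁ q₂ h₁ h₂
  rcases h₁ with ⟨⟨x, b, y⟩, h, e⟩ | ⟨⟨x, b, y⟩, h, e⟩ <;>
  rcases h₂ with ⟨⟨x', b', y'⟩, h', e'⟩ | ⟨⟨x', b', y'⟩, h', e'⟩ <;>
  cases e <;> cases e'
  · rw [hA _ _ _ _ h h']
  · rw [hB _ _ _ _ h h']

theorem bigSum_succ_unique : ∀ l : List (TELA Sym), (∀ A ∈ l, A.IsDeterministic) →
    ∀ q a q₁ q₂, (q, a, q₁) ∈ (bigSum l).δ → (q, a, q₂) ∈ (bigSum l).δ → q₁ = q₂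
  | [], _ => fun q => nomatch q
  | [A], h => fun q a _ _ h₁ h₂ => ((h A (by simp)).2 q a).unique h₁ h₂
  | A :: B :: l, h =>
    sum_succ_unique
      (fun q a _ _ h₁ h₂ => ((h A (by simp)).2 q a).unique h₁ h₂)
      (bigSum_succ_unique (B :: l) fun C hC => h C (List.mem_cons_of_mem _ hC))

/-- With an empty nondeterministic part, the conditions on crossings and on accepting runs are
vacuous. -/
theorem isLimitDeterministic_bigSum (l : List (TELA Sym)) (h : ∀ A ∈ l, A.IsDeterministic) :
    (bigSum l).IsLimitDeterministic :=
  ⟨∅, Set.univ, by simp, by simp, by simp, fun q _ => bigSum_succ_unique l h q, by simp⟩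

theorem size_sum (A B : TELA Sym) : (A.sum B).size = A.size + B.size := by
  have := A.finite
  have := B.finite
  exact Nat.card_sum

theorem size_bigSum : ∀ l : List (TELA Sym), (bigSum l).size = (l.map size).sum
  | [] => by simp [bigSum, size, empty]
  | [A] => by simp [bigSum]
  | A :: B :: l => by
      rw [bigSum, size_sum, size_bigSum (B :: l), List.map_cons, List.map_cons, List.map_cons,
        List.sum_cons, List.sum_cons, List.sum_cons]

/-! ### Deterministic Rabin automata from finite congruences on words. -/

/-- A deterministic machine that reads finite words (latest letter first) through the finite
abstraction `code` yields a deterministic automaton, with a Rabin condition given by `bad` and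
`good`. -/
theorem exists_deterministic_of_code [Finite Sym] {Y ι : Type} [Finite Y] [Finite ι]
    (code : List Sym → Y)
    (hcode : ∀ u v a, code u = code v → code (a :: u) = code (a :: v))
    (bad good : ι → List Sym → Sym → Prop)
    (hbad : ∀ c u v a, code u = code v → (bad c u a ↔ bad c v a))
    (hgood : ∀ c u v a, code u = code v → (good c u a ↔ good c v a))
    (pre : (ℕ → Sym) → ℕ → List Sym)
    (pre_zero : ∀ w, pre w 0 = []) (pre_succ : ∀ w t, pre w (t + 1) = w t :: pre w t) :
    ∃ B : TELA Sym, B.IsDeterministic ∧ B.size = Nat.card Y ∧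
      B.language = {w | ∃ c, (∀ᶠ t in atTop, ¬ bad c (pre w t) (w t)) ∧
        ∃ᶠ t in atTop, good c (pre w t) (w t)} := by
  classical
  -- By `hcode` the chosen representative does not matter. The default on codes of no word only
  -- keeps the transition function total.
  let next : Y → Sym → Y := fun y a =>
    if h : ∃ u, code u = y then code (a :: h.choose) else y
  have next_code : ∀ u a, next (code u) a = code (a :: u) := by
    intro u a
    have h : ∃ v, code v = code u := ⟨u, rfl⟩
    simp only [next, dif_pos h]
    exact hcode _ _ _ h.choose_spec
  let δ : Set (Edge Y Sym) := {e | e.2.2 = next e.1 e.2.1}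
  let lift : (List Sym → Sym → Prop) → Set (Edge Y Sym) := fun p =>
    {e | e ∈ δ ∧ ∃ u, code u = e.1 ∧ p u e.2.1}
  cases nonempty_fintype ι
  let acc : ELCond (Edge Y Sym) := .bigOr ((Finset.univ : Finset ι).toList.map fun c =>
    .and (.finAtom (lift (bad c))) (.infAtom (lift (good c))))
  let B : TELA Sym :=
    { State := Y
      finite := inferInstance
      δ := δ
      init := {code []}
      acc := acc
      acc_over := by
        simp only [acc, ELCond.over_bigOr, List.mem_map, Finset.mem_toList, Finset.mem_univ,
          true_and, forall_exists_index, forall_apply_eq_imp_iff, ELCond.Over]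
        exact fun c => ⟨fun e h => h.1, fun e h => h.1⟩ }
  have hrun : ∀ w ρ, B.IsRun w ρ ↔
      ρ = fun t => (code (pre w t), w t, code (pre w (t + 1))) := by
    intro w ρ
    constructor
    · rintro ⟨h0, h1, h2, h3⟩
      have key : ∀ t, (ρ t).1 = code (pre w t) := by
        intro t
        induction t with
        | zero => rw [pre_zero]; exact h0
        | succ t ih =>
          have := h1 t
          rw [← h3 t, this, ih, h2, next_code, pre_succ]
      funext t
      have e3 := h3 t
      rw [key] at e3
      exact Prod.ext (key t) (Prod.ext (h2 t) e3)
    · rintro rfl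
      refine ⟨?_, fun t => ?_, fun t => rfl, fun t => rfl⟩
      · change code (pre w 0) = code []
        rw [pre_zero]
      · change code (pre w (t + 1)) = next (code (pre w t)) (w t)
        rw [next_code, pre_succ]
  have hlift : ∀ (p : List Sym → Sym → Prop), (∀ u v a, code u = code v → (p u a ↔ p v a)) →
      ∀ w t, ((code (pre w t), w t, code (pre w (t + 1))) : Edge Y Sym) ∈ lift p ↔
        p (pre w t) (w t) := by
    intro p hp w t
    constructor
    · rintro ⟨-, u, hu, h⟩
      exact (hp _ _ _ hu).1 h
    · intro h
      refine ⟨?_, _, rfl, h⟩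
      change code (pre w (t + 1)) = next (code (pre w t)) (w t)
      rw [next_code, pre_succ]
  refine ⟨B, ⟨⟨code [], rfl, fun _ h => h⟩, fun q a => ⟨next q a, rfl, fun _ h => h⟩⟩, rfl, ?_⟩
  ext w
  have : ∀ ρ, B.IsAcceptingRun w ρ ↔ B.IsRun w ρ ∧ ∃ c, (∀ᶠ t in atTop, ρ t ∉ lift (bad c)) ∧
      ∃ᶠ t in atTop, ρ t ∈ lift (good c) := by
    intro ρ
    have : Finite (Edge B.State Sym) := inferInstanceAs (Finite (Y × Sym × Y))
    refine and_congr_right fun _ => ?_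
    simp only [B, acc, ELCond.sat_bigOr, List.mem_map, Finset.mem_toList, Finset.mem_univ,
      true_and, exists_exists_eq_and, ELCond.Sat]
    refine exists_congr fun c => and_congr ?_ ?_
    · exact infSet_inter_eq_empty
    · exact infSet_inter_nonempty
  simp only [language, this, hrun, Set.mem_ofPred_eq, exists_eq_left]
  refine exists_congr fun c => ?_
  simp only [hlift _ (hbad c), hlift _ (hgood c)]

end TELA

/-! ### Limit arguments for finite layers and decreasing sequences. -/

/-- Kőnig's lemma for layers of a finite type. -/
theorem exists_infinite_path {Q : Type} [Finite Q] (G : ℕ → Q → Prop) (R : ℕ → Q → Q → Prop)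
    (hne : ∀ t, ∃ q, G t q) (hpar : ∀ t q', G (t + 1) q' → ∃ q, G t q ∧ R t q q') :
    ∃ f : ℕ → Q, (∀ t, G t (f t)) ∧ ∀ t, R t (f t) (f (t + 1)) := by
  have hfin : ∀ n q, G n q → ∃ g : ℕ → Q, g n = q ∧ (∀ t ≤ n, G t (g t)) ∧
      ∀ t < n, R t (g t) (g (t + 1)) := by
    intro n
    induction n with
    | zero =>
      intro q hq
      exact ⟨fun _ => q, rfl, fun t ht => by rwa [Nat.le_zero.1 ht], by simp⟩
    | succ n ih =>
      intro q' hq'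
      obtain ⟨q, hq, hR⟩ := hpar n q' hq'
      obtain ⟨g, rfl, hG, hg⟩ := ih q hq
      refine ⟨fun t => if t ≤ n then g t else q', by simp, fun t ht => ?_, fun t ht => ?_⟩
      · by_cases h : t ≤ n
        · simpa [h] using hG t h
        · obtain rfl : t = n + 1 := by omega
          simpa using hq'
      · rcases Nat.lt_succ_iff_lt_or_eq.1 ht with h | rfl
        · simpa [h.le, Nat.succ_le_of_lt h] using hg t h
        · simpa using hR
  choose q hq using hne
  choose g hgq hgG hgR using fun n => hfin n (q n) (hq n)
  -- The infinite path is the pointwise ultrafilter limit of the finite paths `g n`; it exists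
  -- because `Q` is finite.
  have hlim : ∀ t, ∃ x, ∀ᶠ n in (hyperfilter ℕ : Filter ℕ), g n t = x := by
    intro t
    by_contra h
    have h' : ∀ x, ∀ᶠ n in (hyperfilter ℕ : Filter ℕ), ¬ g n t = x := fun x =>
      Ultrafilter.eventually_not.2 fun hx => h ⟨x, hx⟩
    obtain ⟨n, hn⟩ := (eventually_all.2 h').exists
    exact hn _ rfl
  choose f hf using hlim
  have hle : ∀ t, ∀ᶠ n in (hyperfilter ℕ : Filter ℕ), t < n := fun t =>
    (Nat.cofinite_eq_atTop ▸ hyperfilter_le_cofinite : (hyperfilter ℕ : Filter ℕ) ≤ atTop)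
      (eventually_gt_atTop t)
  refine ⟨f, fun t => ?_, fun t => ?_⟩
  · obtain ⟨n, h1, h2⟩ := ((hf t).and (hle t)).exists
    exact h1 ▸ hgG n t h2.le
  · obtain ⟨n, h1, h2, h3⟩ := ((hf t).and ((hf (t + 1)).and (hle t))).exists
    exact h1 ▸ h2 ▸ hgR n t h3

theorem eventually_const_of_antitone_from {f : ℕ → ℕ} {s : ℕ}
    (hf : ∀ t ≥ s, f (t + 1) ≤ f t) : ∃ b, (∀ᶠ t in atTop, f t = b) ∧ ∀ t ≥ s, b ≤ f t := by
  have hanti : ∀ t ≥ s, ∀ t' ≥ t, f t' ≤ f t := by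
    intro t ht t' ht'
    induction t', ht' using Nat.le_induction with
    | base => exact le_rfl
    | succ n hn ih => exact (hf n (ht.trans hn)).trans ih
  have hne : (f '' Set.Ici s).Nonempty := ⟨f s, s, Set.self_mem_Ici, rfl⟩
  obtain ⟨m, hm, hmb⟩ := Nat.sInf_mem hne
  have hlow : ∀ t ≥ s, sInf (f '' Set.Ici s) ≤ f t := fun t ht => Nat.sInf_le ⟨t, ht, rfl⟩
  refine ⟨sInf (f '' Set.Ici s), ?_, hlow⟩
  filter_upwards [eventually_ge_atTop m] with t ht
  exact le_antisymm ((hanti m hm t ht).trans hmb.le) (hlow t (le_trans hm ht))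

/-! ### Descending chains of levels under a common update. -/

namespace ChainDynamics

variable {α : Type} {E : ℕ → ℕ → α} {upd : ℕ → α → α}

theorem ncard_image_Iic_succ_le (f : ℕ → α) (s : ℕ) :
    (f '' Set.Iic (s + 1)).ncard ≤ (f '' Set.Iic s).ncard + 1 := by
  rw [← Order.succ_eq_add_one, Order.Iic_succ, Set.image_insert_eq]
  exact Set.ncard_insert_le _ _

theorem image_succ (hupd : ∀ t s, s ≤ t → E (t + 1) s = upd t (E t s)) {t s : ℕ} (hs : s ≤ t) :
    E (t + 1) '' Set.Iic s = upd t '' (E t '' Set.Iic s) := by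
  rw [Set.image_image]
  exact Set.image_congr fun r hr => hupd t r (le_trans hr hs)

theorem eq_of_eq (hupd : ∀ t s, s ≤ t → E (t + 1) s = upd t (E t s)) {t₀ s r : ℕ}
    (hs : s ≤ t₀) (hr : r ≤ t₀) (h : E t₀ r = E t₀ s) : ∀ t ≥ t₀, E t r = E t s := by
  intro t ht
  induction t, ht using Nat.le_induction with
  | base => exact h
  | succ t ht ih => rw [hupd t r (hr.trans ht), hupd t s (hs.trans ht), ih]

/-- The number of distinct levels up to `s` is the monotone quantity behind all convergence below.
-/
theorem ncard_succ_le (hupd : ∀ t s, s ≤ t → E (t + 1) s = upd t (E t s)) {t s : ℕ}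
    (hs : s ≤ t) : (E (t + 1) '' Set.Iic s).ncard ≤ (E t '' Set.Iic s).ncard := by
  rw [image_succ hupd hs]
  exact Set.ncard_image_le (Set.toFinite _)

variable [PartialOrder α]

/-- The position of `x` in a chain, counted from the top. -/
noncomputable def pos (C : Set α) (x : α) : ℕ := {y ∈ C | x ≤ y}.ncard

/-- The members of a chain whose position is at most `c`. -/
def upper (C : Set α) (c : ℕ) : Set α := {x ∈ C | pos C x ≤ c}

theorem setOf_le_eq (hE : ∀ t, Antitone (E t)) {t s : ℕ} (hs : s ≤ t) :
    {y ∈ E t '' Set.Iic t | E t s ≤ y} = E t '' Set.Iic s := by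
  ext y
  constructor
  · rintro ⟨⟨r, hr, rfl⟩, hle⟩
    rcases le_total r s with h | h
    · exact ⟨r, h, rfl⟩
    · exact ⟨s, Set.mem_Iic.2 le_rfl, le_antisymm hle (hE t h)⟩
  · rintro ⟨r, hr, rfl⟩
    exact ⟨⟨r, le_trans hr hs, rfl⟩, hE t hr⟩

theorem pos_eq (hE : ∀ t, Antitone (E t)) {t s : ℕ} (hs : s ≤ t) :
    pos (E t '' Set.Iic t) (E t s) = (E t '' Set.Iic s).ncard := by
  rw [pos, setOf_le_eq hE hs]

/-- No new value occurs between `s` and `r`, so `E t r` equals some `E t p` with `p ≤ s`, and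
antitonicity squeezes it. -/
theorem eq_of_ncard_eq (hE : ∀ t, Antitone (E t)) {t s r : ℕ} (hsr : s ≤ r)
    (h : (E t '' Set.Iic r).ncard ≤ (E t '' Set.Iic s).ncard) : E t r = E t s := by
  have hsub : E t '' Set.Iic s ⊆ E t '' Set.Iic r := Set.image_mono (Set.Iic_subset_Iic.2 hsr)
  have := Set.eq_of_subset_of_ncard_le hsub h (Set.toFinite _)
  obtain ⟨p, hp, e⟩ : E t r ∈ E t '' Set.Iic s := this ▸ ⟨r, Set.mem_Iic.2 le_rfl, rfl⟩
  exact le_antisymm (hE t hsr) (e ▸ hE t hp)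

theorem ncard_eq_of_eq (hE : ∀ t, Antitone (E t)) {t s r : ℕ} (hsr : s ≤ r)
    (h : E t r = E t s) : (E t '' Set.Iic r).ncard = (E t '' Set.Iic s).ncard := by
  congr 1
  refine Set.Subset.antisymm ?_ (Set.image_mono (Set.Iic_subset_Iic.2 hsr))
  rintro _ ⟨p, hp, rfl⟩
  rcases le_total p s with h' | h'
  · exact ⟨p, h', rfl⟩
  · exact ⟨s, Set.mem_Iic.2 le_rfl, le_antisymm (h ▸ hE t hp) (hE t h')⟩

theorem upper_eq (hE : ∀ t, Antitone (E t)) {t s c : ℕ} (hs : s ≤ t)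
    (hc : (E t '' Set.Iic s).ncard = c) : upper (E t '' Set.Iic t) c = E t '' Set.Iic s := by
  ext y
  constructor
  · rintro ⟨⟨r, hr, rfl⟩, hle⟩
    rw [pos_eq hE hr, ← hc] at hle
    rcases le_total r s with h | h
    · exact ⟨r, h, rfl⟩
    · exact ⟨s, Set.mem_Iic.2 le_rfl, (eq_of_ncard_eq hE h hle).symm⟩
  · rintro ⟨r, hr, rfl⟩
    refine ⟨⟨r, le_trans hr hs, rfl⟩, ?_⟩
    rw [pos_eq hE (le_trans hr hs), ← hc]
    exact Set.ncard_le_ncard (Set.image_mono (Set.Iic_subset_Iic.2 hr)) (Set.toFinite _)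

variable [Finite α]

/-- Some level absorbs all later ones, and its position is detected by the collapses. -/
theorem exists_absorbing (hE : ∀ t, Antitone (E t))
    (hupd : ∀ t s, s ≤ t → E (t + 1) s = upd t (E t s)) :
    ∃ s c, c ≤ Nat.card α ∧ (∀ r ≥ s, ∀ᶠ t in atTop, E t r = E t s) ∧
      (∀ᶠ t in atTop, pos (E t '' Set.Iic t) (E t s) = c ∧
        (upd t '' upper (E t '' Set.Iic t) c).ncard = c) ∧
      ∃ᶠ t in atTop, (upd t '' upper (E t '' Set.Iic t) (c + 1)).ncard ≤ c := by
  have hconst := fun s => eventually_const_of_antitone_from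
    (f := fun t => (E t '' Set.Iic s).ncard) (s := s) fun t ht => ncard_succ_le hupd ht
  choose k hk _ using hconst
  have kmono : Monotone k := by
    intro s r hsr
    obtain ⟨t, h1, h2⟩ := ((hk s).and (hk r)).exists
    rw [← h1, ← h2]
    exact Set.ncard_le_ncard (Set.image_mono (Set.Iic_subset_Iic.2 hsr)) (Set.toFinite _)
  have kle : ∀ s, k s ≤ Nat.card α := by
    intro s
    obtain ⟨t, h1⟩ := (hk s).exists
    rw [← h1]
    exact Set.ncard_le_card _
  -- `s` maximizes the limiting number of distinct levels.
  obtain ⟨s, hs⟩ : ∃ s, ∀ r ≥ s, k r = k s := by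
    have hb : BddAbove (Set.range k) := ⟨_, by rintro _ ⟨s, rfl⟩; exact kle s⟩
    obtain ⟨s, hs⟩ := Nat.sSup_mem (Set.range_nonempty k) hb
    exact ⟨s, fun r hr => le_antisymm (hs ▸ le_csSup hb ⟨r, rfl⟩) (kmono hr)⟩
  have habs : ∀ r ≥ s, ∀ᶠ t in atTop, E t r = E t s := by
    intro r hr
    filter_upwards [hk r, hk s] with t h1 h2
    exact eq_of_ncard_eq hE hr (by rw [h1, h2, hs r hr])
  refine ⟨s, k s, kle s, habs, ?_, ?_⟩
  · filter_upwards [hk s, (tendsto_add_atTop_nat 1).eventually (hk s), eventually_ge_atTop s]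
      with t h1 h2 h3
    refine ⟨by rw [pos_eq hE h3, h1], ?_⟩
    rw [upper_eq hE h3 h1, ← image_succ hupd h3, h2]
  · intro hev
    obtain ⟨t₀, h⟩ := eventually_atTop.1 (hev.and ((hk s).and (eventually_ge_atTop s)))
    obtain ⟨hn, h1, h2⟩ := h t₀ le_rfl
    -- there is a level at position `k s + 1`
    obtain ⟨r, hr, hrt⟩ : ∃ r ≤ t₀, (E t₀ '' Set.Iic r).ncard = k s + 1 := by
      have hlt : k s < (E t₀ '' Set.Iic t₀).ncard := by
        by_contra hle
        refine hn ((Set.ncard_image_le (Set.toFinite _)).trans ?_)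
        exact (Set.ncard_le_ncard (fun x hx => hx.1) (Set.toFinite _)).trans (not_lt.1 hle)
      have hex : ∃ r, k s < (E t₀ '' Set.Iic r).ncard := ⟨t₀, hlt⟩
      classical
      -- The count grows by at most one per index, so the first level beyond `k s` has position
      -- exactly `k s + 1`.
      refine ⟨Nat.find hex, Nat.find_min' hex hlt, le_antisymm ?_ (Nat.find_spec hex)⟩
      have hpos : Nat.find hex ≠ 0 := by
        intro h0
        have := Nat.find_spec hex
        rw [h0] at this
        have h4 : (E t₀ '' Set.Iic 0).ncard ≤ (E t₀ '' Set.Iic s).ncard :=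
          Set.ncard_le_ncard (Set.image_mono (Set.Iic_subset_Iic.2 (Nat.zero_le _)))
            (Set.toFinite _)
        omega
      obtain ⟨p, hp⟩ := Nat.exists_eq_succ_of_ne_zero hpos
      have h5 := Nat.find_min hex (m := p) (by omega)
      rw [hp]
      exact (ncard_image_Iic_succ_le _ _).trans (by omega)
    -- Without further collapses this level would keep its position, giving `k r = k s + 1` against
    -- the maximality of `k s`.
    have hstay : ∀ t ≥ t₀, (E t '' Set.Iic r).ncard = k s + 1 := by
      intro t ht
      induction t, ht using Nat.le_induction with
      | base => exact hrt
      | succ t ht ih =>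
        have hc : ¬ (upd t '' upper (E t '' Set.Iic t) (k s + 1)).ncard ≤ k s := (h t ht).1
        rw [upper_eq hE (hr.trans ht) ih, ← image_succ hupd (hr.trans ht)] at hc
        have := ncard_succ_le hupd (hr.trans ht)
        omega
    have hsr : s ≤ r := by
      by_contra hlt
      have : (E t₀ '' Set.Iic r).ncard ≤ (E t₀ '' Set.Iic s).ncard :=
        Set.ncard_le_ncard (Set.image_mono (Set.Iic_subset_Iic.2 (by omega))) (Set.toFinite _)
      omega
    obtain ⟨t, h3, h4⟩ := ((hk r).and (eventually_ge_atTop t₀)).exists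
    rw [hstay t h4, hs r hsr] at h3
    omega

/-- Conversely, the collapses determine an absorbing level. -/
theorem absorbing_of_collapse (hE : ∀ t, Antitone (E t))
    (hupd : ∀ t s, s ≤ t → E (t + 1) s = upd t (E t s)) {c : ℕ}
    (h₁ : ∀ᶠ t in atTop, (∃ x ∈ E t '' Set.Iic t, pos (E t '' Set.Iic t) x = c) ∧
      (upd t '' upper (E t '' Set.Iic t) c).ncard = c)
    (h₂ : ∃ᶠ t in atTop, (upd t '' upper (E t '' Set.Iic t) (c + 1)).ncard ≤ c) :
    ∃ s, (∀ᶠ t in atTop, ∀ x ∈ E t '' Set.Iic t, pos (E t '' Set.Iic t) x = c → x = E t s) ∧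
      ∀ r ≥ s, ∀ᶠ t in atTop, E t r = E t s := by
  obtain ⟨t₀, h⟩ := eventually_atTop.1 h₁
  obtain ⟨⟨_, ⟨s, hs, rfl⟩, hc⟩, -⟩ := h t₀ le_rfl
  rw [Set.mem_Iic] at hs
  rw [pos_eq hE hs] at hc
  have hstay : ∀ t ≥ t₀, (E t '' Set.Iic s).ncard = c := by
    intro t ht
    induction t, ht using Nat.le_induction with
    | base => exact hc
    | succ t ht ih =>
      have := (h t ht).2
      rwa [upper_eq hE (hs.trans ht) ih, ← image_succ hupd (hs.trans ht)] at this
  -- Once level `r` has merged with `s`, level `r + 1` has position at most `c + 1`, so the next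
  -- collapse merges it with `s` too.
  have habs : ∀ r ≥ s, ∀ᶠ t in atTop, E t r = E t s := by
    intro r hr
    induction r, hr using Nat.le_induction with
    | base => simp
    | succ r hr ih =>
      obtain ⟨t₁, hg⟩ := eventually_atTop.1 (ih.and (eventually_ge_atTop (max t₀ (r + 1))))
      obtain ⟨t, hcol, ht⟩ := (h₂.and_eventually (eventually_ge_atTop t₁)).exists
      obtain ⟨he, hle⟩ := hg t ht
      have hrt : r + 1 ≤ t := le_of_max_le_right hle
      have ht0 : t₀ ≤ t := le_of_max_le_left hle
      have hcr : (E t '' Set.Iic r).ncard = c := by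
        rw [ncard_eq_of_eq hE hr he, hstay t ht0]
      have hsub : E t '' Set.Iic (r + 1) ⊆ upper (E t '' Set.Iic t) (c + 1) := by
        rintro _ ⟨p, hp, rfl⟩
        have hp' : p ≤ t := le_trans hp hrt
        refine ⟨⟨p, hp', rfl⟩, ?_⟩
        rw [pos_eq hE hp']
        exact (Set.ncard_le_ncard (Set.image_mono (Set.Iic_subset_Iic.2 hp))
          (Set.toFinite _)).trans ((ncard_image_Iic_succ_le _ _).trans (by omega))
      have hle' : (E (t + 1) '' Set.Iic (r + 1)).ncard ≤ c := by
        rw [image_succ hupd hrt]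
        exact (Set.ncard_le_ncard (Set.image_mono hsub) (Set.toFinite _)).trans hcol
      have heq : E (t + 1) (r + 1) = E (t + 1) s :=
        eq_of_ncard_eq hE (by omega) (by rw [hstay (t + 1) (by omega)]; exact hle')
      filter_upwards [eventually_ge_atTop (t + 1)] with t' ht'
      exact eq_of_eq hupd (by omega) (by omega) heq t' ht'
  refine ⟨s, ?_, habs⟩
  filter_upwards [eventually_ge_atTop t₀] with t ht
  rintro _ ⟨r, hr, rfl⟩ hp
  rw [Set.mem_Iic] at hr
  rw [pos_eq hE hr] at hp
  have hst := hstay t ht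
  rcases le_total r s with h' | h'
  · exact (eq_of_ncard_eq hE h' (by omega)).symm
  · exact eq_of_ncard_eq hE h' (by omega)

end ChainDynamics

/-! ### Least histories, their levels, and the finite information about them. -/

/-- A generalized Büchi automaton whose acceptance sets `T 0, …, T (M - 1)` are awaited
cyclically. -/
structure CyclicBuchi (Sym Q : Type) where
  δ : Set (Edge Q Sym)
  init : Set Q
  M : ℕ
  T : ℕ → Set (Edge Q Sym)

namespace CyclicBuchi

/-- The number of zeros among the last `t` binary digits. -/
def zeros : ℕ → ℕ → ℕ
  | 0, _ => 0
  | t + 1, v => zeros t (v / 2) + if v % 2 = 0 then 1 else 0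

variable {Sym Q : Type} (G : CyclicBuchi Sym Q)

/-- The states reachable by a word; the latest letter comes first. -/
def reach : List Sym → Set Q
  | [] => G.init
  | a :: u => {q' | ∃ q ∈ reach u, (q, a, q') ∈ G.δ}

open Classical in
/-- The digit of a transition after a history `v` of length `t`: it is zero iff the transition
belongs to the awaited acceptance set. -/
noncomputable def digit (t v : ℕ) (e : Edge Q Sym) : ℕ :=
  if e ∈ G.T (zeros t v % G.M) then 0 else 1

/-- The lexicographically least history of a run that leads to a state, as a binary number. -/
noncomputable def hist : List Sym → Q → ℕ
  | [], _ => 0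
  | a :: u, q' => sInf {n | ∃ q ∈ G.reach u, (q, a, q') ∈ G.δ ∧
      n = 2 * hist u q + G.digit u.length (hist u q) (q, a, q')}

/-- The digit of the transition from `q` to `q'` after the word `u`. -/
noncomputable def bit (u : List Sym) (a : Sym) (q q' : Q) : ℕ :=
  G.digit u.length (G.hist u q) (q, a, q')

/-- `q` is a predecessor through which the least history of `q'` passes. -/
def IsParent (u : List Sym) (a : Sym) (q q' : Q) : Prop :=
  q ∈ G.reach u ∧ (q, a, q') ∈ G.δ ∧ ∀ p ∈ G.reach u, (p, a, q') ∈ G.δ →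
    2 * G.hist u q + G.bit u a q q' ≤ 2 * G.hist u p + G.bit u a p q'

variable {G} {u v : List Sym} {a : Sym} {q q' p p' : Q}

theorem bit_le_one : G.bit u a q q' ≤ 1 := by
  unfold bit digit
  split <;> omega

theorem bit_eq_zero : G.bit u a q q' = 0 ↔
    (q, a, q') ∈ G.T (zeros u.length (G.hist u q) % G.M) := by
  unfold bit digit
  split <;> simp_all

theorem hist_cons_le (hq : q ∈ G.reach u) (h : (q, a, q') ∈ G.δ) :
    G.hist (a :: u) q' ≤ 2 * G.hist u q + G.bit u a q q' :=
  Nat.sInf_le ⟨q, hq, h, rfl⟩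

theorem exists_parent (h : q' ∈ G.reach (a :: u)) : ∃ q, G.IsParent u a q q' := by
  obtain ⟨p, hp, hpe⟩ := h
  obtain ⟨q, hq, he, hn⟩ := Nat.sInf_mem (s := {n | ∃ q ∈ G.reach u, (q, a, q') ∈ G.δ ∧
      n = 2 * G.hist u q + G.digit u.length (G.hist u q) (q, a, q')}) ⟨_, p, hp, hpe, rfl⟩
  exact ⟨q, hq, he, fun r hr hre => hn ▸ hist_cons_le hr hre⟩

theorem IsParent.mem (h : G.IsParent u a q q') : q' ∈ G.reach (a :: u) := ⟨q, h.1, h.2.1⟩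

theorem IsParent.hist_eq (h : G.IsParent u a q q') :
    G.hist (a :: u) q' = 2 * G.hist u q + G.bit u a q q' := by
  refine le_antisymm (hist_cons_le h.1 h.2.1) (le_csInf ⟨_, q, h.1, h.2.1, rfl⟩ ?_)
  rintro n ⟨p, hp, hpe, rfl⟩
  exact h.2.2 p hp hpe

theorem IsParent.hist_div (h : G.IsParent u a q q') : G.hist (a :: u) q' / 2 = G.hist u q := by
  have := bit_le_one (G := G) (u := u) (a := a) (q := q) (q' := q')
  rw [h.hist_eq]
  omega

theorem IsParent.hist_mod (h : G.IsParent u a q q') :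
    G.hist (a :: u) q' % 2 = G.bit u a q q' := by
  have := bit_le_one (G := G) (u := u) (a := a) (q := q) (q' := q')
  rw [h.hist_eq]
  omega

theorem IsParent.zeros_eq (h : G.IsParent u a q q') :
    zeros (a :: u).length (G.hist (a :: u) q') =
      zeros u.length (G.hist u q) + if G.bit u a q q' = 0 then 1 else 0 := by
  rw [List.length_cons, zeros, h.hist_div, h.hist_mod]

/-- Pairs of a relation on the states and a set of states. -/
abbrev Elt (Q : Type) : Type := (Q → Q → Prop) × (Q → Prop)

variable (G) in
/-- The relation of having the same history up to the last `d` digits, and the set of states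
with a zero among these digits. -/
def elt (u : List Sym) (d : ℕ) : Elt Q :=
  (fun q q' => q ∈ G.reach u ∧ q' ∈ G.reach u ∧ G.hist u q / 2 ^ d = G.hist u q' / 2 ^ d,
    fun q => q ∈ G.reach u ∧ ∃ e < d, G.hist u q / 2 ^ e % 2 = 0)

variable (G) in
/-- The effect of reading a letter on the pairs `elt`. -/
def upd (u : List Sym) (a : Sym) (x : Elt Q) : Elt Q :=
  (fun q q' => ∃ p p', G.IsParent u a p q ∧ G.IsParent u a p' q' ∧ x.1 p p',
    fun q => ∃ p, G.IsParent u a p q ∧ (x.2 p ∨ G.bit u a p q = 0))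

variable (G) in
def chain (u : List Sym) : Set (Elt Q) := {x | ∃ d ≤ u.length, G.elt u d = x}

theorem elt_mono : Monotone (G.elt u) := by
  intro d d' hd
  refine ⟨fun q q' ⟨h₁, h₂, h₃⟩ => ⟨h₁, h₂, ?_⟩, fun q ⟨h₁, e, he, h₂⟩ => ⟨h₁, e, by omega, h₂⟩⟩
  obtain ⟨k, rfl⟩ := Nat.exists_eq_add_of_le hd
  rw [pow_add, ← Nat.div_div_eq_div_mul, ← Nat.div_div_eq_div_mul, h₃]

theorem div_two_pow_succ (n d : ℕ) : n / 2 ^ (d + 1) = n / 2 / 2 ^ d := by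
  rw [pow_succ', Nat.div_div_eq_div_mul]

/-- A parent's history is the child's without its last digit, so a fixed cut is transported along
parents; the new digit can only add marks. -/
theorem elt_cons_succ (d : ℕ) : G.elt (a :: u) (d + 1) = G.upd u a (G.elt u d) := by
  refine Prod.ext (funext₂ fun q q' => propext ⟨?_, ?_⟩) (funext fun q => propext ⟨?_, ?_⟩)
  · rintro ⟨h, h', e⟩
    obtain ⟨p, hp⟩ := exists_parent h
    obtain ⟨p', hp'⟩ := exists_parent h'
    refine ⟨p, p', hp, hp', hp.1, hp'.1, ?_⟩
    rwa [div_two_pow_succ, div_two_pow_succ, hp.hist_div, hp'.hist_div] at e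
  · rintro ⟨p, p', hp, hp', -, -, e⟩
    refine ⟨hp.mem, hp'.mem, ?_⟩
    rwa [div_two_pow_succ, div_two_pow_succ, hp.hist_div, hp'.hist_div]
  · rintro ⟨h, e, he, h0⟩
    obtain ⟨p, hp⟩ := exists_parent h
    refine ⟨p, hp, ?_⟩
    cases e with
    | zero => exact Or.inr (by rwa [pow_zero, Nat.div_one, hp.hist_mod] at h0)
    | succ e =>
      rw [div_two_pow_succ, hp.hist_div] at h0
      exact Or.inl ⟨hp.1, e, by omega, h0⟩
  · rintro ⟨p, hp, ⟨-, e, he, h0⟩ | h0⟩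
    · exact ⟨hp.mem, e + 1, by omega, by rwa [div_two_pow_succ, hp.hist_div]⟩
    · exact ⟨hp.mem, 0, by omega, by rwa [pow_zero, Nat.div_one, hp.hist_mod]⟩

theorem elt_zero : G.elt u 0 =
    (fun q q' => q ∈ G.reach u ∧ q' ∈ G.reach u ∧ G.hist u q = G.hist u q', fun _ => False) := by
  simp [elt]

theorem chain_cons : G.chain (a :: u) = insert (G.elt (a :: u) 0) (G.upd u a '' G.chain u) := by
  ext x
  constructor
  · rintro ⟨d, hd, rfl⟩
    cases d with
    | zero => exact Or.inl rfl
    | succ d =>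
      refine Or.inr ⟨_, ⟨d, by simpa using hd, rfl⟩, (elt_cons_succ d).symm⟩
  · rintro (rfl | ⟨_, ⟨d, hd, rfl⟩, rfl⟩)
    · exact ⟨0, by simp, rfl⟩
    · exact ⟨d + 1, by simpa using hd, elt_cons_succ d⟩

variable (G) in
/-- Two words that are not distinguished by the finite information on which the deterministic
automaton is based. -/
structure Similar (u v : List Sym) : Prop where
  reach_eq : G.reach u = G.reach v
  le_iff : ∀ q ∈ G.reach u, ∀ q' ∈ G.reach u,
    (G.hist u q ≤ G.hist u q' ↔ G.hist v q ≤ G.hist v q')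
  zeros_eq : ∀ q ∈ G.reach u,
    zeros u.length (G.hist u q) % G.M = zeros v.length (G.hist v q) % G.M
  chain_eq : G.chain u = G.chain v

namespace Similar

theorem bit_eq (h : G.Similar u v) (hq : q ∈ G.reach u) : G.bit u a q q' = G.bit v a q q' := by
  unfold bit digit
  rw [h.zeros_eq q hq]

/-- Digits are at most 1, so histories decide the comparison and digits only break ties; similarity
preserves both. -/
theorem step_le_iff (h : G.Similar u v) (hp : p ∈ G.reach u) (hq : q ∈ G.reach u) :
    2 * G.hist u p + G.bit u a p p' ≤ 2 * G.hist u q + G.bit u a q q' ↔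
      2 * G.hist v p + G.bit v a p p' ≤ 2 * G.hist v q + G.bit v a q q' := by
  have h₁ := h.le_iff p hp q hq
  have h₂ := h.le_iff q hq p hp
  have b₁ := bit_le_one (G := G) (u := v) (a := a) (q := p) (q' := p')
  have b₂ := bit_le_one (G := G) (u := v) (a := a) (q := q) (q' := q')
  rw [h.bit_eq hp, h.bit_eq hq]
  omega

theorem isParent_iff (h : G.Similar u v) : G.IsParent u a q q' ↔ G.IsParent v a q q' := by
  unfold IsParent
  rw [← h.reach_eq]
  refine and_congr_right fun hq => and_congr_right fun _ => forall₂_congr fun p hp => ?_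
  rw [h.step_le_iff hq hp]

theorem upd_eq (h : G.Similar u v) : G.upd u a = G.upd v a := by
  funext x
  unfold upd
  simp only [h.isParent_iff]
  congr 1
  funext q
  refine propext (exists_congr fun p => and_congr_right fun hp => ?_)
  rw [h.bit_eq (h.isParent_iff.2 hp).1]

/-- This congruence property makes the similarity class a legitimate state of a deterministic
automaton. -/
theorem cons (h : G.Similar u v) (a : Sym) : G.Similar (a :: u) (a :: v) := by
  have hr : G.reach (a :: u) = G.reach (a :: v) := by
    simp only [reach, h.reach_eq]
  have hle : ∀ q ∈ G.reach (a :: u), ∀ q' ∈ G.reach (a :: u),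
      (G.hist (a :: u) q ≤ G.hist (a :: u) q' ↔ G.hist (a :: v) q ≤ G.hist (a :: v) q') := by
    intro q hq q' hq'
    obtain ⟨p, hp⟩ := exists_parent hq
    obtain ⟨p', hp'⟩ := exists_parent hq'
    rw [hp.hist_eq, hp'.hist_eq, (h.isParent_iff.1 hp).hist_eq, (h.isParent_iff.1 hp').hist_eq,
      h.step_le_iff hp.1 hp'.1]
  refine ⟨hr, hle, fun q hq => ?_, ?_⟩
  · obtain ⟨p, hp⟩ := exists_parent hq
    rw [hp.zeros_eq, (h.isParent_iff.1 hp).zeros_eq, h.bit_eq hp.1, Nat.add_mod,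
      h.zeros_eq p hp.1, ← Nat.add_mod]
  · rw [chain_cons, chain_cons, h.chain_eq, h.upd_eq, elt_zero, elt_zero, ← hr]
    congr 2
    funext q q'
    refine propext (and_congr_right fun hq => and_congr_right fun hq' => ?_)
    have h₁ := hle q hq q' hq'
    have h₂ := hle q' hq' q hq
    omega

end Similar

/-! ### The Rabin condition and its correctness. -/

open ChainDynamics

variable (G) in
/-- Some class of the relation is covered by the set. -/
def Full (u : List Sym) (x : Elt Q) : Prop := ∃ q ∈ G.reach u, ∀ q', x.1 q q' → x.2 q'

variable (G) in
/-- The `c`-th member of the chain has a covered class, and the first `c` members survive. -/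
def Stable (c : ℕ) (u : List Sym) (a : Sym) : Prop :=
  (∃ x ∈ G.chain u, pos (G.chain u) x = c ∧ G.Full u x) ∧
    (G.upd u a '' upper (G.chain u) c).ncard = c

variable (G) in
/-- One of the first `c + 1` members of the chain is missing or vanishes. -/
def Collapse (c : ℕ) (u : List Sym) (a : Sym) : Prop :=
  (G.upd u a '' upper (G.chain u) (c + 1)).ncard ≤ c

theorem Similar.stable_iff (h : G.Similar u v) {c : ℕ} : G.Stable c u a ↔ G.Stable c v a := by
  unfold Stable Full
  rw [h.chain_eq, h.upd_eq, h.reach_eq]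

theorem Similar.collapse_iff (h : G.Similar u v) {c : ℕ} :
    G.Collapse c u a ↔ G.Collapse c v a := by
  unfold Collapse
  rw [h.chain_eq, h.upd_eq]

/-- The prefix of length `t` of a word, latest letter first. -/
def pre (w : ℕ → Sym) : ℕ → List Sym
  | 0 => []
  | t + 1 => w t :: pre w t

theorem length_pre (w : ℕ → Sym) (t : ℕ) : (pre w t).length = t := by
  induction t with
  | zero => rfl
  | succ t ih => rw [pre, List.length_cons, ih]

variable (G) in
/-- The pair that belongs to the first `s` digits of the histories of length `t`. -/
def level (w : ℕ → Sym) (t s : ℕ) : Elt Q := G.elt (pre w t) (t - s)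

theorem level_antitone (w : ℕ → Sym) (t : ℕ) : Antitone (G.level w t) :=
  fun _ _ h => elt_mono (Nat.sub_le_sub_left h t)

theorem level_succ (w : ℕ → Sym) (t s : ℕ) (h : s ≤ t) :
    G.level w (t + 1) s = G.upd (pre w t) (w t) (G.level w t s) := by
  rw [level, pre, Nat.succ_sub h, elt_cons_succ, level]

theorem chain_pre (w : ℕ → Sym) (t : ℕ) : G.chain (pre w t) = G.level w t '' Set.Iic t := by
  ext x
  rw [chain, length_pre]
  constructor
  · rintro ⟨d, hd, rfl⟩
    exact ⟨t - d, Set.mem_Iic.2 (by omega), by rw [level, Nat.sub_sub_self hd]⟩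
  · rintro ⟨s, hs, rfl⟩
    exact ⟨t - s, by omega, rfl⟩

variable (G) in
/-- `f` is the sequence of states of an accepting run for `w`. -/
structure Accepts (w : ℕ → Sym) (f : ℕ → Q) : Prop where
  init : f 0 ∈ G.init
  step : ∀ t, (f t, w t, f (t + 1)) ∈ G.δ
  recur : ∀ i < G.M, ∃ᶠ t in atTop, (f t, w t, f (t + 1)) ∈ G.T i

end CyclicBuchi

namespace CyclicBuchi

open ChainDynamics

variable {Sym Q : Type} {G : CyclicBuchi Sym Q} {w : ℕ → Sym} {f : ℕ → Q}

theorem hist_pre_lt (t : ℕ) : ∀ q ∈ G.reach (pre w t), G.hist (pre w t) q < 2 ^ t := by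
  induction t with
  | zero => simp [pre, hist]
  | succ t ih =>
    intro q hq
    obtain ⟨p, hp⟩ := exists_parent hq
    have h₁ := ih p hp.1
    have h₂ := hp.hist_div
    rw [pow_succ]
    change G.hist (w t :: pre w t) q < _
    omega

theorem hist_path_div (hf : ∀ t, G.IsParent (pre w t) (w t) (f t) (f (t + 1))) (t e : ℕ) :
    G.hist (pre w (t + e)) (f (t + e)) / 2 ^ e = G.hist (pre w t) (f t) := by
  induction e with
  | zero => simp
  | succ e ih =>
    rw [div_two_pow_succ, ← add_assoc]
    change G.hist (w (t + e) :: pre w (t + e)) (f (t + e + 1)) / 2 / 2 ^ e = _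
    rw [(hf (t + e)).hist_div, ih]

/-- The counter rises by one at each zero and is unbounded, so it leaves every sufficiently large
value congruent to `i`, and it does so at a zero. -/
theorem frequently_awaited {z b : ℕ → ℕ} {M i : ℕ} (hi : i < M)
    (hz : ∀ t, z (t + 1) = z t + if b t = 0 then 1 else 0) (hb : ∃ᶠ t in atTop, b t = 0) :
    ∃ᶠ t in atTop, b t = 0 ∧ z t % M = i := by
  have hmono : Monotone z := monotone_nat_of_le_succ fun t => by rw [hz]; omega
  have hunb : ∀ m, ∃ t, m < z t := by
    intro m
    induction m with
    | zero =>
      obtain ⟨t, ht⟩ := hb.exists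
      exact ⟨t + 1, by rw [hz, if_pos ht]; omega⟩
    | succ m ih =>
      obtain ⟨t, ht⟩ := ih
      obtain ⟨t', h₁, h₂⟩ := (hb.and_eventually (eventually_ge_atTop t)).exists
      exact ⟨t' + 1, by rw [hz, if_pos h₁]; have := hmono h₂; omega⟩
  rw [frequently_atTop]
  intro t₀
  have hM : 0 < M := by omega
  -- the target value of the counter
  let m := z t₀ * M + i
  have hm : z t₀ ≤ m := (Nat.le_mul_of_pos_right _ hM).trans (Nat.le_add_right _ _)
  classical
  have hex := hunb m
  have hspec := Nat.find_spec hex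
  have hpos : t₀ < Nat.find hex := by
    by_contra hle
    have := hmono (not_lt.1 hle)
    omega
  obtain ⟨t, ht⟩ := Nat.exists_eq_succ_of_ne_zero (Nat.ne_of_gt (Nat.zero_lt_of_lt hpos))
  have hmin := Nat.find_min hex (m := t) (by omega)
  rw [ht, Nat.succ_eq_add_one, hz] at hspec
  have hbt : b t = 0 := by
    by_contra hne
    rw [if_neg hne] at hspec
    omega
  rw [if_pos hbt] at hspec
  have hzt : z t = m := by omega
  refine ⟨t, by omega, hbt, ?_⟩
  rw [hzt, Nat.mul_add_mod_self_right, Nat.mod_eq_of_lt hi]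

theorem accepts_of_frequently_zero
    (hf : ∀ t, G.IsParent (pre w t) (w t) (f t) (f (t + 1)))
    (hb : ∃ᶠ t in atTop, G.bit (pre w t) (w t) (f t) (f (t + 1)) = 0) : G.Accepts w f where
  init := (hf 0).1
  step t := (hf t).2.1
  recur i hi := by
    have := frequently_awaited (z := fun t => zeros t (G.hist (pre w t) (f t))) hi
      (fun t => by
        have := (hf t).zeros_eq
        rwa [List.length_cons, length_pre] at this) hb
    refine this.mono fun t ⟨h₁, h₂⟩ => ?_
    rw [bit_eq_zero, length_pre] at h₁
    rwa [h₂] at h₁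

/-- A covered class of an absorbing level stays covered. A Kőnig path of parents inside it has a
zero after every cut, because every later level merges with the absorbing one. -/
theorem exists_accepts_of_stable [Finite Q] {c : ℕ}
    (hs : ∀ᶠ t in atTop, G.Stable c (pre w t) (w t))
    (hc : ∃ᶠ t in atTop, G.Collapse c (pre w t) (w t)) : ∃ f, G.Accepts w f := by
  simp only [Stable, Collapse, chain_pre] at hs hc
  obtain ⟨s, hpos, habs⟩ := absorbing_of_collapse (level_antitone (G := G) w)
    (upd := fun t => G.upd (pre w t) (w t)) (level_succ w)
    (hs.mono fun t ⟨⟨x, h₁, h₂, _⟩, h₃⟩ => ⟨⟨x, h₁, h₂⟩, h₃⟩) hc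
  -- Before time `s` the prefix is not yet complete, so only reachability is required.
  let P : ℕ → ℕ → Q → Prop := fun x t q =>
    q ∈ G.reach (pre w t) ∧ (s ≤ t → G.hist (pre w t) q / 2 ^ (t - s) = x)
  have hpar : ∀ x t q', P x (t + 1) q' →
      ∃ q, P x t q ∧ G.IsParent (pre w t) (w t) q q' := by
    rintro x t q' ⟨h₁, h₂⟩
    obtain ⟨q, hq⟩ := exists_parent h₁
    refine ⟨q, ⟨hq.1, fun hst => ?_⟩, hq⟩
    rw [← h₂ (by omega), Nat.succ_sub hst, div_two_pow_succ, pre, hq.hist_div]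
  -- some class of the level `s` is covered again and again
  obtain ⟨x, hx⟩ : ∃ x, ∃ᶠ t in atTop, s ≤ t ∧ (∃ q, P x t q) ∧
      ∀ q, P x t q → (G.level w t s).2 q := by
    by_contra hno
    push Not at hno
    -- There are only `2 ^ s` prefixes of length `s`, so one of them labels a covered class
    -- infinitely often.
    have hall : ∀ x : Fin (2 ^ s), ∀ᶠ t in atTop, ¬ (s ≤ t ∧ (∃ q, P x t q) ∧
        ∀ q, P x t q → (G.level w t s).2 q) := fun x => not_frequently.1 fun h => by
      obtain ⟨t, ⟨h₁, h₂, h₃⟩, h₄⟩ := (h.and_eventually (hno x)).exists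
      obtain ⟨q, hq, hq'⟩ := h₄ h₁ h₂
      exact hq' (h₃ q hq)
    obtain ⟨t, h₁, h₂, h₃, h₄⟩ := ((eventually_all.2 hall).and
      ((hpos.and hs).and (eventually_ge_atTop s))).exists.imp
        fun t h => (⟨h.1, h.2.1.1, h.2.1.2, h.2.2⟩ : _ ∧ _ ∧ _ ∧ _)
    obtain ⟨⟨y, hy, hyc, q, hq, hfull⟩, -⟩ := h₃
    obtain rfl := h₂ y hy hyc
    have hlt := hist_pre_lt t q hq
    have hx : G.hist (pre w t) q / 2 ^ (t - s) < 2 ^ s := by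
      rw [Nat.div_lt_iff_lt_mul (by positivity), ← pow_add, Nat.add_sub_cancel' h₄]
      exact hlt
    exact h₁ ⟨_, hx⟩ ⟨h₄, ⟨q, hq, fun _ => rfl⟩, fun q' hq' =>
      hfull q' ⟨hq, hq'.1, (hq'.2 h₄).symm⟩⟩
  have hcov : ∀ᶠ t in atTop, ∀ q, P x t q → (G.level w t s).2 q := by
    obtain ⟨t₀, hst, -, h₀⟩ := hx.exists
    filter_upwards [eventually_ge_atTop t₀] with t ht
    induction t, ht using Nat.le_induction with
    | base => exact h₀
    | succ t ht ih =>
      intro q' hq'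
      obtain ⟨q, hq, hqq⟩ := hpar x t q' hq'
      rw [level_succ w t s (hst.trans ht)]
      exact ⟨q, hqq, Or.inl (ih q hq)⟩
  have hne : ∀ t, ∃ q, P x t q := by
    intro t
    obtain ⟨t', ⟨-, h, -⟩, ht⟩ := (hx.and_eventually (eventually_ge_atTop t)).exists
    clear_value P
    induction t', ht using Nat.le_induction with
    | base => exact h
    | succ t' _ ih =>
      obtain ⟨q', hq'⟩ := h
      obtain ⟨q, hq, -⟩ := hpar x t' q' hq'
      exact ih ⟨q, hq⟩
  obtain ⟨f, hfP, hf⟩ := exists_infinite_path (P x)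
    (fun t => G.IsParent (pre w t) (w t)) hne (hpar x)
  refine ⟨f, accepts_of_frequently_zero hf (frequently_atTop.2 fun r => ?_)⟩
  obtain ⟨t, h₁, h₂⟩ := (hcov.and (habs (max r s) (le_max_right _ _))).exists
  have h₃ := h₁ (f t) (hfP t)
  rw [← h₂] at h₃
  obtain ⟨-, e, he, h0⟩ := h₃
  have hr : r ≤ max r s := le_max_left _ _
  obtain ⟨k, hk⟩ : ∃ k, t = k + 1 + e := ⟨t - e - 1, by omega⟩
  subst hk
  refine ⟨k, by omega, ?_⟩
  rw [hist_path_div hf, pre, (hf k).hist_mod] at h0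
  exact h0

theorem Accepts.mem_reach (h : G.Accepts w f) (t : ℕ) : f t ∈ G.reach (pre w t) := by
  induction t with
  | zero => exact h.init
  | succ t ih => exact ⟨f t, ih, h.step t⟩

theorem Accepts.hist_succ_le (h : G.Accepts w f) (t : ℕ) : G.hist (pre w (t + 1)) (f (t + 1)) ≤
    2 * G.hist (pre w t) (f t) + G.bit (pre w t) (w t) (f t) (f (t + 1)) :=
  hist_cons_le (h.mem_reach t) (h.step t)

/-- The histories of the states of an accepting run converge to a sequence of digits with
infinitely many zeros. -/
theorem Accepts.exists_limit (h : G.Accepts w f) (hM : 0 < G.M) :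
    ∃ β : ℕ → ℕ, (∀ s, ∀ᶠ t in atTop, G.hist (pre w t) (f t) / 2 ^ (t - s) = β s) ∧
      ∃ᶠ s in atTop, β s % 2 = 0 := by
  let H : ℕ → ℕ := fun t => G.hist (pre w t) (f t)
  let b : ℕ → ℕ := fun t => G.bit (pre w t) (w t) (f t) (f (t + 1))
  have hH : ∀ t, H (t + 1) ≤ 2 * H t + b t := h.hist_succ_le
  have hb : ∀ t, b t ≤ 1 := fun t => bit_le_one
  have hstep : ∀ s, ∀ t ≥ s, H (t + 1) / 2 ^ (t + 1 - s) ≤ H t / 2 ^ (t - s) := by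
    intro s t ht
    rw [Nat.succ_sub ht, div_two_pow_succ]
    refine Nat.div_le_div_right ?_
    have := hH t
    have := hb t
    omega
  choose β hβ hβle using fun s => eventually_const_of_antitone_from
    (f := fun t => H t / 2 ^ (t - s)) (hstep s)
  have hβdiv : ∀ s, β (s + 1) / 2 = β s := by
    intro s
    obtain ⟨t, ⟨h₁, h₂⟩, h₃⟩ := (((hβ s).and (hβ (s + 1))).and
      (eventually_ge_atTop (s + 1))).exists
    rw [← h₁, ← h₂, Nat.div_div_eq_div_mul, ← pow_succ]
    congr 2
    omega
  refine ⟨β, hβ, fun hev => ?_⟩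
  -- If all digits of the limit after `s` were ones, it would be the largest extension of its
  -- prefix. The histories are bounded below by it, so they would eventually equal it and their
  -- counters would freeze. The run still meets the awaited set, which would give a smaller history.
  obtain ⟨s, hs⟩ := eventually_atTop.1 hev
  have hβs : ∀ t ≥ s, β t + 1 = (β s + 1) * 2 ^ (t - s) := by
    intro t ht
    induction t, ht using Nat.le_induction with
    | base => simp
    | succ t ht ih =>
      have h₁ := hs (t + 1) (by omega)
      have h₂ := hβdiv t
      rw [Nat.succ_sub ht, pow_succ, ← mul_assoc, ← ih]
      omega
  have hHβ : ∀ᶠ t in atTop, H t = β t := by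
    filter_upwards [hβ s, eventually_ge_atTop s] with t h₁ h₂
    have h₃ := hβle t t le_rfl
    rw [Nat.sub_self, pow_zero, Nat.div_one] at h₃
    have h₄ : H t < (H t / 2 ^ (t - s) + 1) * 2 ^ (t - s) :=
      (Nat.div_lt_iff_lt_mul (by positivity)).1 (Nat.lt_succ_self _)
    rw [h₁, ← hβs t h₂] at h₄
    omega
  obtain ⟨t₀, ht₀⟩ := eventually_atTop.1 (hHβ.and (eventually_ge_atTop s))
  have hodd : ∀ t ≥ t₀, H (t + 1) = 2 * H t + 1 := by
    intro t ht
    have h₁ := hs (t + 1) (by have := (ht₀ t ht).2; omega)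
    have h₂ := hβdiv t
    rw [(ht₀ t ht).1, (ht₀ (t + 1) (by omega)).1]
    omega
  have hzeros : ∀ t ≥ t₀, zeros t (H t) = zeros t₀ (H t₀) := by
    intro t ht
    induction t, ht using Nat.le_induction with
    | base => rfl
    | succ t ht ih =>
      rw [zeros, hodd t ht, ← ih, if_neg (by omega), add_zero,
        show (2 * H t + 1) / 2 = H t by omega]
  obtain ⟨t, h₁, h₂⟩ := ((h.recur _ (Nat.mod_lt (zeros t₀ (H t₀)) hM)).and_eventually
    (eventually_ge_atTop t₀)).exists
  have h₃ : b t = 0 := by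
    refine bit_eq_zero.2 ?_
    rw [length_pre]
    change _ ∈ G.T (zeros t (H t) % G.M)
    rwa [hzeros t h₂]
  have h₄ := hH t
  rw [hodd t h₂] at h₄
  omega

/-- Choose a zero of the limit history beyond the absorbing level `s`, at digit `r`. Eventually all
states in the class of `f t` at level `r` share that zero, and level `r` has merged with level `s`,
so this class is covered. -/
theorem Accepts.exists_stable [Finite Q] (h : G.Accepts w f) (hM : 0 < G.M) :
    ∃ c ≤ Nat.card (Elt Q), (∀ᶠ t in atTop, G.Stable c (pre w t) (w t)) ∧
      ∃ᶠ t in atTop, G.Collapse c (pre w t) (w t) := by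
  obtain ⟨β, hβ, hzero⟩ := h.exists_limit hM
  obtain ⟨s, c, hc, habs, hst, hcol⟩ := exists_absorbing (level_antitone (G := G) w)
    (upd := fun t => G.upd (pre w t) (w t)) (level_succ w)
  refine ⟨c, hc, ?_, by simpa only [Collapse, chain_pre] using hcol⟩
  obtain ⟨r, hr0, hr⟩ := (hzero.and_eventually (eventually_gt_atTop s)).exists
  simp only [Stable, chain_pre]
  filter_upwards [hst, habs r hr.le, hβ r, eventually_ge_atTop r] with t h₁ h₂ h₃ h₄
  refine ⟨⟨_, ⟨s, Set.mem_Iic.2 (by omega), rfl⟩, h₁.1, f t, h.mem_reach t, fun q hq => ?_⟩, h₁.2⟩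
  rw [← h₂] at hq
  obtain ⟨-, hq, e⟩ := hq
  exact ⟨hq, t - r, by omega, by rw [← e, h₃, hr0]⟩

theorem exists_accepts_iff [Finite Q] (hM : 0 < G.M) : (∃ f, G.Accepts w f) ↔
    ∃ c : Fin (Nat.card (Elt Q) + 1), (∀ᶠ t in atTop, G.Stable c (pre w t) (w t)) ∧
      ∃ᶠ t in atTop, G.Collapse c (pre w t) (w t) := by
  constructor
  · rintro ⟨f, h⟩
    obtain ⟨c, hc, h'⟩ := h.exists_stable hM
    exact ⟨⟨c, by omega⟩, h'⟩
  · rintro ⟨c, h₁, h₂⟩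
    exact exists_accepts_of_stable h₁ h₂

end CyclicBuchi

/-! ### Coding chains of subsets of a finite set. -/

namespace ChainCode

variable {W : Type} [Finite W]

/-- The cardinalities of the members of a family. -/
def cards (C : Set (Set W)) (n : Fin (Nat.card W + 1)) : Prop := ∃ S ∈ C, S.ncard = n

/-- The least cardinality of a member that contains a given point. -/
noncomputable def least (C : Set (Set W)) (x : W) : Fin (Nat.card W + 2) :=
  -- The default `Nat.card W + 1` exceeds every cardinality and marks points that lie in no member.
  ⟨sInf (insert (Nat.card W + 1) {n | ∃ S ∈ C, x ∈ S ∧ S.ncard = n}),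
    Nat.lt_succ_of_le (Nat.sInf_le (Set.mem_insert _ _))⟩

theorem mem_iff_least_le {C : Set (Set W)} (hC : ∀ S ∈ C, ∀ S' ∈ C, S ⊆ S' ∨ S' ⊆ S) {S : Set W}
    (hS : S ∈ C) {x : W} : x ∈ S ↔ (least C x : ℕ) ≤ S.ncard := by
  constructor
  · exact fun h => Nat.sInf_le (Or.inr ⟨S, hS, h, rfl⟩)
  · intro h
    have hmem := Nat.sInf_mem (s := insert (Nat.card W + 1) {n | ∃ S ∈ C, x ∈ S ∧ S.ncard = n})
      ⟨_, Set.mem_insert _ _⟩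
    have hle : sInf (insert (Nat.card W + 1) {n | ∃ S ∈ C, x ∈ S ∧ S.ncard = n}) ≤ S.ncard := h
    have hcard := Set.ncard_le_card S
    rcases hmem with h' | ⟨S', hS', hx, h'⟩
    · omega
    · rcases hC S' hS' S hS with hsub | hsub
      · exact hsub hx
      · rwa [Set.eq_of_subset_of_ncard_le hsub (by omega) (Set.toFinite _)]

/-- In a chain, cardinality identifies a member, and `least` then recovers its points. -/
theorem subset_of_code {C C' : Set (Set W)} (hC : ∀ S ∈ C, ∀ S' ∈ C, S ⊆ S' ∨ S' ⊆ S)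
    (hC' : ∀ S ∈ C', ∀ S' ∈ C', S ⊆ S' ∨ S' ⊆ S) (h₁ : cards C = cards C')
    (h₂ : least C = least C') : C ⊆ C' := by
  intro S hS
  have hn : cards C ⟨S.ncard, Nat.lt_succ_of_le (Set.ncard_le_card S)⟩ := ⟨S, hS, rfl⟩
  rw [h₁] at hn
  obtain ⟨S', hS', e⟩ := hn
  have : S = S' := by
    ext x
    rw [mem_iff_least_le hC hS, mem_iff_least_le hC' hS', h₂, e]
  rwa [this]

end ChainCode

/-! ### Coding levels by sets, and counting states. -/

namespace CyclicBuchi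

variable {Sym Q : Type} {G : CyclicBuchi Sym Q} {u v : List Sym} {a : Sym} {q q' : Q}

variable (G) in
/-- The states that are not minimal in their class, together with the marked states. -/
def trace (u : List Sym) (x : Elt Q) : Set (Q ⊕ Q) :=
  {z | Sum.elim (fun q => q ∈ G.reach u ∧ ∃ p ∈ G.reach u, G.hist u p < G.hist u q ∧ x.1 p q)
    x.2 z}

theorem trace_mono : Monotone (G.trace u) := by
  rintro x y ⟨h₁, h₂⟩ (q | q)
  · rintro ⟨hq, p, hp, hlt, h⟩
    exact ⟨hq, p, hp, hlt, h₁ p q h⟩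
  · exact h₂ q

/-- The classes are intervals with respect to the histories. -/
theorem elt_rel_iff {d : ℕ} (hq : q ∈ G.reach u) (hq' : q' ∈ G.reach u)
    (hle : G.hist u q ≤ G.hist u q') : (G.elt u d).1 q q' ↔
      ∀ r ∈ G.reach u, ¬ G.hist u r ≤ G.hist u q → G.hist u r ≤ G.hist u q' →
        Sum.inl r ∈ G.trace u (G.elt u d) := by
  constructor
  · rintro ⟨-, -, e⟩ r hr h₁ h₂
    refine ⟨hr, q, hq, not_le.1 h₁, hq, hr, ?_⟩
    have h₃ := Nat.div_le_div_right (c := 2 ^ d) (not_le.1 h₁).le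
    have h₄ := Nat.div_le_div_right (c := 2 ^ d) h₂
    omega
  · intro h
    -- A non-minimal `q'` has a classmate `p` with smaller history. Either `p` is not above `q`, and
    -- monotonicity of the prefixes places `q` in the class, or the descent continues from `p`.
    induction hn : G.hist u q' using Nat.strong_induction_on generalizing q' with
    | _ n ih =>
      subst hn
      rcases hle.eq_or_lt with e | hlt
      · exact ⟨hq, hq', by rw [e]⟩
      · obtain ⟨-, p, hp, hpq, -, -, e⟩ := h q' hq' (not_le.2 hlt) le_rfl
        rcases le_total (G.hist u p) (G.hist u q) with hle' | hle'
        · have h₃ := Nat.div_le_div_right (c := 2 ^ d) hle'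
          have h₄ := Nat.div_le_div_right (c := 2 ^ d) hle
          exact ⟨hq, hq', by omega⟩
        · obtain ⟨-, -, e'⟩ := ih _ hpq hp hle' (fun r hr h₁ h₂ => h r hr h₁ (h₂.trans hpq.le)) rfl
          exact ⟨hq, hq', e'.trans e⟩

/-- Interval classes are recovered from the common order of histories and the non-minimal states. -/
theorem elt_eq_of_trace_eq {d d' : ℕ} (hr : G.reach u = G.reach v)
    (hle : ∀ q ∈ G.reach u, ∀ q' ∈ G.reach u,
      (G.hist u q ≤ G.hist u q' ↔ G.hist v q ≤ G.hist v q'))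
    (h : G.trace u (G.elt u d) = G.trace v (G.elt v d')) : G.elt u d = G.elt v d' := by
  have key : ∀ q ∈ G.reach u, ∀ q' ∈ G.reach u, G.hist u q ≤ G.hist u q' →
      ((G.elt u d).1 q q' ↔ (G.elt v d').1 q q') := by
    intro q hq q' hq' hqq
    rw [elt_rel_iff hq hq' hqq,
      elt_rel_iff (hr ▸ hq) (hr ▸ hq') ((hle q hq q' hq').1 hqq), ← h, ← hr]
    refine forall₂_congr fun r hr' => ?_
    rw [hle r hr' q hq, hle r hr' q' hq']
  have symm : ∀ (w : List Sym) e p p', (G.elt w e).1 p p' → (G.elt w e).1 p' p :=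
    fun _ _ _ _ ⟨h₁, h₂, h₃⟩ => ⟨h₂, h₁, h₃.symm⟩
  refine Prod.ext (funext₂ fun q q' => propext ?_) (funext fun q => propext ?_)
  · by_cases hq : q ∈ G.reach u ∧ q' ∈ G.reach u
    · rcases le_total (G.hist u q) (G.hist u q') with h' | h'
      · exact key q hq.1 q' hq.2 h'
      · exact ⟨fun hx => symm _ _ _ _ ((key q' hq.2 q hq.1 h').1 (symm _ _ _ _ hx)),
          fun hx => symm _ _ _ _ ((key q' hq.2 q hq.1 h').2 (symm _ _ _ _ hx))⟩
    · exact ⟨fun hx => (hq ⟨hx.1, hx.2.1⟩).elim, fun hx => (hq ⟨hr ▸ hx.1, hr ▸ hx.2.1⟩).elim⟩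
  · exact Set.ext_iff.1 h (Sum.inr q)

theorem trace_image_isChain : ∀ S ∈ G.trace u '' G.chain u, ∀ S' ∈ G.trace u '' G.chain u,
    S ⊆ S' ∨ S' ⊆ S := by
  rintro _ ⟨_, ⟨d, -, rfl⟩, rfl⟩ _ ⟨_, ⟨d', -, rfl⟩, rfl⟩
  exact (le_total d d').imp (fun h => trace_mono (elt_mono h)) fun h => trace_mono (elt_mono h)

variable [Finite Q]

variable (G) in
/-- The position of a reachable state in the order of the histories. -/
noncomputable def rank (u : List Sym) (q : Q) : Fin (Nat.card Q + 1) :=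
  -- Requiring `q` to be reachable gives unreachable states rank 0, so the code depends only on the
  -- similarity class.
  ⟨{p | q ∈ G.reach u ∧ p ∈ G.reach u ∧ ¬ G.hist u q ≤ G.hist u p}.ncard,
    Nat.lt_succ_of_le (Set.ncard_le_card _)⟩

theorem rank_le_iff (hq : q ∈ G.reach u) (hq' : q' ∈ G.reach u) :
    G.rank u q ≤ G.rank u q' ↔ G.hist u q ≤ G.hist u q' := by
  constructor
  · intro h
    by_contra hlt
    refine (not_lt.2 h) (Set.ncard_lt_ncard ⟨?_, fun hsub => ?_⟩ (Set.toFinite _))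
    · rintro p ⟨-, hp, hpq⟩
      exact ⟨hq, hp, by omega⟩
    · exact (hsub ⟨hq, hq', hlt⟩).2.2 le_rfl
  · intro h
    refine Set.ncard_le_ncard ?_ (Set.toFinite _)
    rintro p ⟨-, hp, hpq⟩
    exact ⟨hq', hp, by omega⟩

/-- The states of the deterministic automaton. -/
abbrev Code (Q : Type) (M : ℕ) : Type :=
  (Q → Fin (Nat.card Q + 1)) × (Q → Prop) × (Q → Fin M) ×
    (Fin (Nat.card (Q ⊕ Q) + 1) → Prop) × (Q ⊕ Q → Fin (Nat.card (Q ⊕ Q) + 2))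

open Classical in
variable (G) in
noncomputable def code (hM : 0 < G.M) (u : List Sym) : Code Q G.M :=
  (G.rank u, (· ∈ G.reach u),
    fun q => ⟨(if q ∈ G.reach u then zeros u.length (G.hist u q) else 0) % G.M, Nat.mod_lt _ hM⟩,
    ChainCode.cards (G.trace u '' G.chain u), ChainCode.least (G.trace u '' G.chain u))

open Classical in
-- Both directions are used: equal codes give similarity, which survives a letter, and similarity
-- gives equal codes again.
theorem code_eq_iff {hM : 0 < G.M} : G.code hM u = G.code hM v ↔ G.Similar u v := by
  constructor
  · intro h
    simp only [code, Prod.mk.injEq] at h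
    obtain ⟨h₁, h₂, h₃, h₄, h₅⟩ := h
    have hr : G.reach u = G.reach v := h₂
    have hle : ∀ q ∈ G.reach u, ∀ q' ∈ G.reach u,
        (G.hist u q ≤ G.hist u q' ↔ G.hist v q ≤ G.hist v q') := by
      intro q hq q' hq'
      rw [← rank_le_iff hq hq', ← rank_le_iff (hr ▸ hq) (hr ▸ hq'), h₁]
    refine ⟨hr, hle, fun q hq => ?_, ?_⟩
    · have := congrArg Fin.val (congrFun h₃ q)
      simpa only [if_pos hq, if_pos (hr ▸ hq : q ∈ G.reach v)] using this
    · have hC : G.trace u '' G.chain u = G.trace v '' G.chain v :=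
        Set.Subset.antisymm
          (ChainCode.subset_of_code trace_image_isChain trace_image_isChain h₄ h₅)
          (ChainCode.subset_of_code trace_image_isChain trace_image_isChain h₄.symm h₅.symm)
      refine Set.Subset.antisymm ?_ ?_
      · rintro _ ⟨d, hd, rfl⟩
        obtain ⟨_, ⟨d', hd', rfl⟩, e⟩ : G.trace u (G.elt u d) ∈ G.trace v '' G.chain v :=
          hC ▸ ⟨_, ⟨d, hd, rfl⟩, rfl⟩
        exact ⟨d', hd', (elt_eq_of_trace_eq hr hle e.symm).symm⟩
      · rintro _ ⟨d, hd, rfl⟩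
        obtain ⟨_, ⟨d', hd', rfl⟩, e⟩ : G.trace v (G.elt v d) ∈ G.trace u '' G.chain u :=
          hC ▸ ⟨_, ⟨d, hd, rfl⟩, rfl⟩
        exact ⟨d', hd', elt_eq_of_trace_eq hr hle e⟩
  · intro h
    have htr : G.trace u = G.trace v := by
      funext x
      ext (q | q)
      · change (_ ∧ ∃ p ∈ _, _ ∧ _) ↔ (_ ∧ ∃ p ∈ _, _ ∧ _)
        rw [← h.reach_eq]
        refine and_congr_right fun hq => exists_congr fun p => and_congr_right fun hp => ?_
        rw [← not_le, h.le_iff q hq p hp, not_le]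
      · exact Iff.rfl
    have hrank : G.rank u = G.rank v := by
      funext q
      refine Fin.ext (congrArg Set.ncard (Set.ext fun p => ?_))
      simp only [Set.mem_ofPred_eq, ← h.reach_eq]
      exact and_congr_right fun hq => and_congr_right fun hp => by rw [h.le_iff q hq p hp]
    have hz : ∀ q, (if q ∈ G.reach u then zeros u.length (G.hist u q) else 0) % G.M =
        (if q ∈ G.reach v then zeros v.length (G.hist v q) else 0) % G.M := by
      intro q
      rw [← h.reach_eq]
      split
      · exact h.zeros_eq q ‹_›
      · rfl
    refine Prod.ext hrank (Prod.ext ?_ (Prod.ext (funext fun q => Fin.ext (hz q)) ?_))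
    · simp only [code, h.reach_eq]
    · simp only [code, htr, h.chain_eq]

theorem card_code (M : ℕ) : Nat.card (Code Q M) =
    (Nat.card Q + 1) ^ Nat.card Q * (2 ^ Nat.card Q * (M ^ Nat.card Q *
      (2 ^ (2 * Nat.card Q + 1) * (2 * Nat.card Q + 2) ^ (2 * Nat.card Q)))) := by
  simp only [Nat.card_prod, Nat.card_fun, Nat.card_fin, Nat.card_sum, two_mul]
  simp

end CyclicBuchi

/-! ### Optimal determinization and the size bounds. -/

namespace TELA

theorem exists_determinization {Sym : Type} [Finite Sym] (A : TELA Sym) {K : ℕ}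
    (T : Fin K → Set (Edge A.State Sym)) (hA : A.acc = ELCond.genBuchi T) :
    ∃ B : TELA Sym, B.IsDeterministic ∧ B.language = A.language ∧
      B.size = (A.size + 1) ^ A.size * (2 ^ A.size * ((K + 1) ^ A.size *
        (2 ^ (2 * A.size + 1) * (2 * A.size + 2) ^ (2 * A.size)))) := by
  have := A.finite
  let G : CyclicBuchi Sym A.State :=
    { δ := A.δ
      init := A.init
      M := K + 1
      -- The additional set `Set.univ` does not affect acceptance and makes the number of awaited
      -- sets positive even for `K = 0`.
      T := fun i => if h : i < K then T ⟨i, h⟩ else Set.univ }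
  have hM : 0 < G.M := Nat.succ_pos K
  have hlang : ∀ w, w ∈ A.language ↔ ∃ f, G.Accepts w f := by
    intro w
    constructor
    · rintro ⟨ρ, ⟨h₀, h₁, h₂, h₃⟩, hacc⟩
      rw [hA, ELCond.sat_genBuchi] at hacc
      have hρ : ∀ t, ((ρ t).1, w t, (ρ (t + 1)).1) = ρ t := fun t =>
        Prod.ext rfl (Prod.ext (h₂ t).symm (h₃ t).symm)
      refine ⟨fun t => (ρ t).1, h₀, fun t => by rw [hρ]; exact h₁ t, fun i _ => ?_⟩
      simp only [hρ, G]
      split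
      · exact infSet_inter_nonempty.1 (hacc _)
      · simpa using Frequently.of_forall fun _ => trivial
    · rintro ⟨f, hf⟩
      refine ⟨fun t => (f t, w t, f (t + 1)), ⟨hf.init, hf.step, fun _ => rfl, fun _ => rfl⟩, ?_⟩
      rw [hA, ELCond.sat_genBuchi]
      intro j
      have := hf.recur j (j.2.trans (Nat.lt_succ_self K))
      simp only [G, j.2, dif_pos] at this
      exact infSet_inter_nonempty.2 this
  obtain ⟨B, hB, hsize, hBl⟩ := exists_deterministic_of_code (G.code hM)
    (ι := Fin (Nat.card (CyclicBuchi.Elt A.State) + 1))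
    (fun u v a h => CyclicBuchi.code_eq_iff.2 ((CyclicBuchi.code_eq_iff.1 h).cons a))
    (fun c u a => ¬ G.Stable c u a) (fun c u a => G.Collapse c u a)
    (fun c u v a h => not_congr (CyclicBuchi.code_eq_iff.1 h).stable_iff)
    (fun c u v a h => (CyclicBuchi.code_eq_iff.1 h).collapse_iff)
    CyclicBuchi.pre (fun _ => rfl) (fun _ _ => rfl)
  refine ⟨B, hB, ?_, hsize.trans (CyclicBuchi.card_code _)⟩
  ext w
  rw [hBl, hlang, CyclicBuchi.exists_accepts_iff hM]
  simp only [Set.mem_ofPred_eq, not_not]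

/-- Since `N * K ≥ 2`, additive and multiplicative constants are absorbed into powers of `N * K`;
the five factors contribute 2 + 1 + 2 + 3 + 6 = 14. -/
theorem determinization_size_le {N K : ℕ} (h : 2 ≤ N * K) :
    (N + 1) ^ N * (2 ^ N * ((K + 1) ^ N * (2 ^ (2 * N + 1) * (2 * N + 2) ^ (2 * N)))) ≤
      (N * K) ^ (14 * N) := by
  have hN : 1 ≤ N := Nat.pos_of_ne_zero (by rintro rfl; simp at h)
  have hK : 1 ≤ K := Nat.pos_of_ne_zero (by rintro rfl; simp at h)
  have hNP : N ≤ N * K := Nat.le_mul_of_pos_right _ hK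
  have hKP : K ≤ N * K := Nat.le_mul_of_pos_left _ hN
  generalize N * K = P at h hNP hKP
  have h1 : (N + 1) ^ N ≤ P ^ (2 * N) := by
    rw [pow_mul]; exact Nat.pow_le_pow_left (by nlinarith) _
  have h2 : 2 ^ N ≤ P ^ N := Nat.pow_le_pow_left h _
  have h3 : (K + 1) ^ N ≤ P ^ (2 * N) := by
    rw [pow_mul]; exact Nat.pow_le_pow_left (by nlinarith) _
  have h4 : 2 ^ (2 * N + 1) ≤ P ^ (3 * N) :=
    (Nat.pow_le_pow_right (by norm_num) (by omega)).trans (Nat.pow_le_pow_left h _)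
  have h5 : (2 * N + 2) ^ (2 * N) ≤ P ^ (6 * N) := by
    rw [show 6 * N = 3 * (2 * N) by ring, pow_mul P 3]
    refine Nat.pow_le_pow_left ?_ _
    have : 2 * 2 * P ≤ P * P * P := Nat.mul_le_mul_right _ (Nat.mul_le_mul h h)
    calc 2 * N + 2 ≤ 2 * 2 * P := by omega
      _ ≤ P * P * P := this
      _ = P ^ 3 := by ring
  calc _ ≤ P ^ (2 * N) * (P ^ N * (P ^ (2 * N) * (P ^ (3 * N) * P ^ (6 * N)))) :=
        Nat.mul_le_mul h1 (Nat.mul_le_mul h2 (Nat.mul_le_mul h3 (Nat.mul_le_mul h4 h5)))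
    _ = P ^ (14 * N) := by simp only [← pow_add]; congr 1; ring

/-- A deterministic automaton with the same language and the least number of states, if there is
any. -/
theorem exists_minimal_determinization (Sym : Type) (A : TELA Sym) : ∃ B : TELA Sym,
    ∀ B' : TELA Sym, B'.IsDeterministic → B'.language = A.language →
      B.IsDeterministic ∧ B.language = A.language ∧ B.size ≤ B'.size := by
  classical
  by_cases h : ∃ n, ∃ B : TELA Sym, B.IsDeterministic ∧ B.language = A.language ∧ B.size = n
  · obtain ⟨B, h₁, h₂, h₃⟩ := Nat.find_spec h
    exact ⟨B, fun B' h₁' h₂' => ⟨h₁, h₂, h₃ ▸ Nat.find_min' h ⟨B', h₁', h₂', rfl⟩⟩⟩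
  · exact ⟨A, fun B' h₁ h₂ => (h ⟨_, B', h₁, h₂, rfl⟩).elim⟩

theorem rpow_log_eq {N K : ℕ} (C : ℝ) (h : 2 ≤ N * K) :
    (2 : ℝ) ^ (C * (N * (Real.logb 2 N + Real.logb 2 K))) = ((N * K : ℕ) : ℝ) ^ (C * N) := by
  have hN : (N : ℝ) ≠ 0 := by rintro h0; simp [Nat.cast_eq_zero.1 h0] at h
  have hK : (K : ℝ) ≠ 0 := by rintro h0; simp [Nat.cast_eq_zero.1 h0] at h
  rw [← Real.logb_mul hN hK, show C * (N * Real.logb 2 (N * K)) =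
    Real.logb 2 (N * K) * (C * N) by ring, Real.rpow_mul (by norm_num),
    Real.rpow_logb (by norm_num) (by norm_num) (by positivity)]
  push_cast
  rfl

theorem exists_optimal_determinization : ∃ det : ∀ Sym : Type, TELA Sym → TELA Sym,
    IsGBADeterminization det ∧ HasOptimalSize det := by
  -- A smallest equivalent automaton depends on no presentation by `K` and `T`, and meets the bound
  -- for every one.
  choose det hdet using exists_minimal_determinization
  refine ⟨det, ?_, 14, ?_⟩
  · intro Sym _ A K T hA
    obtain ⟨B, h₁, h₂, -⟩ := exists_determinization A T hA
    exact ⟨(hdet Sym A B h₁ h₂).1, (hdet Sym A B h₁ h₂).2.1⟩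
  · intro Sym _ A K T hA h
    obtain ⟨B, h₁, h₂, h₃⟩ := exists_determinization A T hA
    have := ((hdet Sym A B h₁ h₂).2.2.trans h₃.le).trans (determinization_size_le h)
    rw [rpow_log_eq 14 h]
    calc ((det Sym A).size : ℝ) ≤ (((A.size * K) ^ (14 * A.size) : ℕ) : ℝ) := by
          exact_mod_cast this
      _ = _ := by
          rw [Nat.cast_pow, ← Real.rpow_natCast]
          push_cast
          rfl

variable {Sym : Type} {A : TELA Sym}

/-- A disjunction of one formula is that formula, so the condition is syntactically generalized
Büchi. -/
theorem DNF.removeFin_splitDNF_acc (D : A.DNF) (i : Fin D.m) :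
    (D.splitDNF i).removeFin.acc = ELCond.genBuchi fun j =>
      liftTrans ((D.splitDNF i).copy (0 : Fin 1)) ((D.splitDNF i).copy (0 : Fin 1))
        (D.T i j \ D.T₀ i) := rfl

theorem DNF.size_removeFin_splitDNF (D : A.DNF) (i : Fin D.m) :
    (D.splitDNF i).removeFin.size = 2 * A.size := by
  have := A.finite
  change Nat.card (A.State ⊕ (Fin 1 × A.State)) = 2 * Nat.card A.State
  simp [two_mul]

theorem DNF.size_limitDetSum (D : A.DNF) (det : TELA Sym → TELA Sym) :
    (D.limitDetSum det).size = ∑ i, (det (D.splitDNF i).removeFin).size := by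
  rw [limitDetSum, size_bigSum, List.map_ofFn, List.sum_ofFn]
  rfl

/-- The base is at most `(n * K) ^ 2` and the exponent carries `2 * n`, hence the factor 4. `max C
0` allows for a negative `C`. -/
theorem two_mul_pow_le {n k K : ℕ} (hk : 1 ≤ k) (hkK : k ≤ K) (h : 2 ≤ n * K) (C : ℝ) :
    ((2 * n * k : ℕ) : ℝ) ^ (C * (2 * n : ℕ)) ≤ ((n * K : ℕ) : ℝ) ^ (4 * max C 0 * n) := by
  have hn : 1 ≤ n := Nat.pos_of_ne_zero (by rintro rfl; simp at h)
  have h1 : 1 ≤ 2 * n * k := Nat.one_le_iff_ne_zero.2 (by positivity)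
  have h2 : 2 * n * k ≤ (n * K) ^ 2 := by
    calc 2 * n * k = 2 * (n * k) := by ring
      _ ≤ (n * K) * (n * K) := Nat.mul_le_mul h (Nat.mul_le_mul_left _ hkK)
      _ = _ := by ring
  calc ((2 * n * k : ℕ) : ℝ) ^ (C * (2 * n : ℕ))
      ≤ ((2 * n * k : ℕ) : ℝ) ^ (max C 0 * (2 * n : ℕ)) :=
        Real.rpow_le_rpow_of_exponent_le (by exact_mod_cast h1)
          (mul_le_mul_of_nonneg_right (le_max_left _ _) (by positivity))
    _ ≤ (((n * K) ^ 2 : ℕ) : ℝ) ^ (max C 0 * (2 * n : ℕ)) :=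
        Real.rpow_le_rpow (by positivity) (by exact_mod_cast h2)
          (mul_nonneg (le_max_right _ _) (by positivity))
    _ = _ := by
        rw [Nat.cast_pow, ← Real.rpow_natCast, ← Real.rpow_mul (by positivity)]
        congr 1
        push_cast
        ring

end TELA

open TELA in
theorem mainTheorem7 :
    (∃ det : ∀ Sym : Type, TELA Sym → TELA Sym,
      IsGBADeterminization det ∧ HasOptimalSize det) ∧
    ∀ det : ∀ Sym : Type, TELA Sym → TELA Sym, IsGBADeterminization det →
      (∀ (Sym : Type) [Finite Sym] (A : TELA Sym) (D : A.DNF),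
        (D.limitDetSum (det Sym)).IsLimitDeterministic ∧
        (D.limitDetSum (det Sym)).size =
          ∑ i, (det Sym (D.splitDNF i).removeFin).size) ∧
      (HasOptimalSize det →
        ∃ C : ℝ, ∀ (Sym : Type) [Finite Sym] (A : TELA Sym) (D : A.DNF),
          2 ≤ A.size * D.maxK →
            ((D.limitDetSum (det Sym)).size : ℝ) ≤
              D.m * (2 : ℝ) ^ (C * (A.size * (Real.logb 2 A.size + Real.logb 2 D.maxK)))) := by
  refine ⟨exists_optimal_determinization, fun det hdet => ⟨fun Sym _ A D => ⟨?_, ?_⟩, ?_⟩⟩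
  · refine isLimitDeterministic_bigSum _ (List.forall_mem_ofFn_iff.2 fun i => ?_)
    exact (hdet Sym _ _ _ (D.removeFin_splitDNF_acc i)).1
  · exact D.size_limitDetSum (det Sym)
  · rintro ⟨C, hC⟩
    refine ⟨4 * max C 0, fun Sym _ A D h => ?_⟩
    rw [D.size_limitDetSum, rpow_log_eq _ h, Nat.cast_sum]
    have hn : 1 ≤ A.size := Nat.pos_of_ne_zero (by rintro h0; simp [h0] at h)
    refine (Finset.sum_le_card_nsmul Finset.univ _
      (((A.size * D.maxK : ℕ) : ℝ) ^ (4 * max C 0 * A.size)) fun i _ => ?_).trans_eq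
      (by rw [Finset.card_univ, Fintype.card_fin, nsmul_eq_mul])
    have hk := D.one_le_k i
    have h2 : 2 ≤ (D.splitDNF i).removeFin.size * D.k i := by
      rw [D.size_removeFin_splitDNF]
      nlinarith
    refine (hC Sym _ _ _ (D.removeFin_splitDNF_acc i) h2).trans ?_
    rw [rpow_log_eq _ h2, D.size_removeFin_splitDNF]
    exact two_mul_pow_le hk (Finset.le_sup (f := D.k) (Finset.mem_univ i)) h C
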